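/- Let $\Bbbk$ be a field, $\Gamma$ a group and $V$ a finite-dimensional (left-left) Yetter–Drinfeld module over $\Bbbk\Gamma$. Let $\mathcal B$ be a pre-Nichols algebra of $V$, i.e. an $\mathbb N$-graded Hopf algebra in ${}^{\Bbbk\Gamma}_{\Bbbk\Gamma}\mathcal{YD}$ with $\mathcal B^0=\Bbbk$ and $\mathcal B^1\cong V$ that is generated as an algebra by $\mathcal B^1$ (equivalently, a graded Hopf algebra quotient of $T(V)$ lying between $T(V)$ and the Nichols algebra $\mathcal B(V)$). Let $H=\mathcal B\#\Bbbk\Gamma$ be the bosonization, let $\operatorname{supp}(V)$ be the (normal) subgroup of $\Gamma$ generated by all $g\in\Gamma$ with $V_g=\{v\in V:\rho(v)=g\otimes v\}\neq 0$, and let $$\varpi\colon H\to \Bbbk[\Gamma/\operatorname{supp}(V)],\qquad \varpi(b\# g)=\varepsilon(b)\,[g].$$ A Hopf algebra map $\pi\colon H\to K$ is cocentral if $(\mathrm{id}\otimes\pi)\Delta=(\mathrm{id}\otimes\pi)\Delta^{\mathrm{op}}$. The Hopf cocenter of $H$ is a cocentral epimorphism of Hopf algebras $p\colon H\to \mathcal{HC}(H)$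 through which every cocentral Hopf algebra map $H\to K$ factors uniquely. The universal grading group $U(H)$ of the category of left $H$-comodules is the group generated by elements $g_X$, one for each simple left $H$-comodule $X$, with the relations: $g_X=g_Y$ if $X\cong Y$; $g_{\Bbbk}=e$; $g_Xg_Y=g_Z$ if $Z$ is a simple subquotient of $X\otimes Y$; and $g_X=g_Y$ if $X$ and $Y$ are simple subquotients of one and the same indecomposable comodule. Then: 1. The universal grading group is $$U(H)\cong\Gamma/\operatorname{supp}(V),$$ by an isomorphism $e$ such that $(\varpi\otimes\mathrm{id})\rho_X(x)=e(g_X)\otimes x$ for every simple left $H$-comodule $X$ with coaction $\rho_X$ and every $x\in X$. 2. $\varpi$ is a cocentral epimorphism of Hopf algebras, and it is universal among cocentral maps to group algebras: for every group $G$ and every cocentral Hopf algebra map $\pi\colon H\to\Bbbk G$ there is a unique group homomorphism $f\colon\Gamma/\operatorname{supp}(V)\to G$ with $\pi=\Bbbk f\circ\varpi$. 3. If $V_1=0$ (no nonzero $v\in V$ satisfies $\rho(v)=1\otimes v$), then $\varpi$ is the Hopf cocenter of $H$; in particular $\mathcal{HC}(H)\cong\Bbbk[\Gamma/\operatorname{supp}(V)]$.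 -/

import Mathlib

open scoped TensorProduct

set_option linter.unusedSectionVars false

noncomputable section

namespace ZestingHopf

universe u v w

/-! ### Comodules -/

/-- A left comodule `M` over a coalgebra `C`, with coaction `ρ : M → C ⊗ M`. -/
class LeftComodule (k : Type u) (C : Type v) (M : Type w) [Field k] [AddCommGroup C] [Module k C]
    [Coalgebra k C] [AddCommGroup M] [Module k M] where
  /-- the coaction -/
  coact : M →ₗ[k] C ⊗[k] M
  coassoc : (TensorProduct.assoc k C C M).toLinearMap ∘ₗ
      Coalgebra.comul.rTensor M ∘ₗ coact = coact.lTensor C ∘ₗ coact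
  counit_coact : (TensorProduct.lid k M).toLinearMap ∘ₗ
      Coalgebra.counit.rTensor M ∘ₗ coact = LinearMap.id

/-- The coaction of a left comodule. -/
abbrev coact (k : Type u) (C : Type v) {M : Type w} [Field k] [AddCommGroup C] [Module k C]
    [Coalgebra k C] [AddCommGroup M] [Module k M] [LeftComodule k C M] : M →ₗ[k] C ⊗[k] M :=
  LeftComodule.coact

section Comodule

variable (k : Type u) (C : Type v) [Field k] [AddCommGroup C] [Module k C] [Coalgebra k C]

/-- A linear map between left comodules which is compatible with the coactions. -/
def IsComoduleHom {M N : Type*} [AddCommGroup M] [Module k M] [LeftComodule k C M]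
    [AddCommGroup N] [Module k N] [LeftComodule k C N] (f : M →ₗ[k] N) : Prop :=
  coact k C ∘ₗ f = f.lTensor C ∘ₗ coact k C

variable (M : Type*) [AddCommGroup M] [Module k M] [LeftComodule k C M]

variable {M} in
/-- A subspace `N` of `M` with `ρ(N) ⊆ C ⊗ N`. -/
def IsSubcomodule (N : Submodule k M) : Prop :=
  ∀ x ∈ N, coact k C x ∈ LinearMap.range (N.subtype.lTensor C)

/-- `M` is a simple comodule. -/
def IsSimpleComodule : Prop :=
  Nontrivial M ∧ ∀ N : Submodule k M, IsSubcomodule k C N → N = ⊥ ∨ N = ⊤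

/-- `M` is an indecomposable comodule: it is not zero, and it is not the direct sum of
two nonzero subcomodules. -/
def IsIndecomposableComodule : Prop :=
  Nontrivial M ∧ ∀ N N' : Submodule k M, IsSubcomodule k C N → IsSubcomodule k C N' →
    IsCompl N N' → N = ⊥ ∨ N' = ⊥

/-- `Z` is a subquotient of `M`: there are a comodule `P`, an injective comodule map `P → M` and a
surjective comodule map `P → Z`. -/
def IsSubquotient (Z M : Type w) [AddCommGroup Z] [Module k Z] [LeftComodule k C Z]
    [AddCommGroup M] [Module k M] [LeftComodule k C M] : Prop :=
  ∃ (P : Type w) (_ : AddCommGroup P) (_ : Module k P) (_ : LeftComodule k C P)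
    (i : P →ₗ[k] M) (p : P →ₗ[k] Z),
    IsComoduleHom k C i ∧ Function.Injective i ∧ IsComoduleHom k C p ∧ Function.Surjective p

end Comodule

section Tensor

variable (k : Type u) (H : Type v) [Field k] [Ring H] [Bialgebra k H]

/-- The trivial comodule `k`, with coaction `1 ↦ 1 ⊗ 1`. -/
instance trivialComodule : LeftComodule k H k where
  coact := TensorProduct.mk k H k 1
  coassoc := by ext; simp [Algebra.TensorProduct.one_def]
  counit_coact := by ext; simp

variable (M N : Type*) [AddCommGroup M] [Module k M] [LeftComodule k H M]
  [AddCommGroup N] [Module k N] [LeftComodule k H N]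

/-- `(a ⊗ m) ⊗ (b ⊗ n) ↦ a b ⊗ (m ⊗ n)`. -/
def mulLegs (M N : Type*) [AddCommGroup M] [Module k M] [AddCommGroup N] [Module k N] :
    (H ⊗[k] M) ⊗[k] (H ⊗[k] N) →ₗ[k] H ⊗[k] (M ⊗[k] N) :=
  (LinearMap.mul' k H).rTensor (M ⊗[k] N) ∘ₗ
    (TensorProduct.tensorTensorTensorComm k H M H N).toLinearMap

@[simp] lemma mulLegs_tmul {M N : Type*} [AddCommGroup M] [Module k M] [AddCommGroup N]
    [Module k N] (a b : H) (m : M) (n : N) :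
    mulLegs k H M N ((a ⊗ₜ m) ⊗ₜ (b ⊗ₜ n)) = (a * b) ⊗ₜ[k] (m ⊗ₜ[k] n) := rfl

/-- The tensor product of two comodules over a bialgebra, with coaction
`m ⊗ n ↦ m₍₋₁₎ n₍₋₁₎ ⊗ m₍₀₎ ⊗ n₍₀₎`. -/
instance tensorComodule : LeftComodule k H (M ⊗[k] N) where
  coact := mulLegs k H M N ∘ₗ TensorProduct.map (coact k H) (coact k H)
  coassoc := by
    let Ω : (H ⊗[k] (H ⊗[k] M)) ⊗[k] (H ⊗[k] (H ⊗[k] N)) →ₗ[k] H ⊗[k] (H ⊗[k] (M ⊗[k] N)) :=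
      (mulLegs k H M N).lTensor H ∘ₗ mulLegs k H (H ⊗[k] M) (H ⊗[k] N)
    have h1 : (TensorProduct.assoc k H H (M ⊗[k] N)).toLinearMap ∘ₗ
        Coalgebra.comul.rTensor (M ⊗[k] N) ∘ₗ mulLegs k H M N = Ω ∘ₗ
        TensorProduct.map ((TensorProduct.assoc k H H M).toLinearMap ∘ₗ Coalgebra.comul.rTensor M)
          ((TensorProduct.assoc k H H N).toLinearMap ∘ₗ Coalgebra.comul.rTensor N) := by
      ext a m b n
      simp only [LinearMap.comp_apply, TensorProduct.AlgebraTensorModule.curry_apply,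
        TensorProduct.curry_apply, LinearMap.coe_restrictScalars, mulLegs_tmul,
        LinearMap.rTensor_tmul, TensorProduct.map_tmul, LinearEquiv.coe_coe,
        Bialgebra.comul_mul]
      generalize (Coalgebra.comul (R := k) a) = x
      generalize (Coalgebra.comul (R := k) b) = y
      induction x with
      | zero => simp
      | add x x' hx hx' => simp only [add_mul, TensorProduct.add_tmul, map_add, hx, hx']
      | tmul x x' =>
        induction y with
        | zero => simp
        | add y y' hy hy' =>
          simp only [mul_add, TensorProduct.add_tmul, TensorProduct.tmul_add, map_add, hy, hy']
        | tmul y y' => simp [Ω]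
    have h2 : (mulLegs k H M N ∘ₗ TensorProduct.map (coact k H) (coact k H)).lTensor H ∘ₗ
        mulLegs k H M N = Ω ∘ₗ
        TensorProduct.map ((coact k H).lTensor H) ((coact k H).lTensor H) := by
      ext a m b n
      simp [Ω]
    clear_value Ω
    rw [← LinearMap.comp_assoc, ← LinearMap.comp_assoc,
      LinearMap.comp_assoc _ _ (TensorProduct.assoc k H H (M ⊗[k] N)).toLinearMap, h1,
      ← LinearMap.comp_assoc, h2, LinearMap.comp_assoc, LinearMap.comp_assoc,
      ← TensorProduct.map_comp, ← TensorProduct.map_comp, LinearMap.comp_assoc,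
      LinearMap.comp_assoc, LeftComodule.coassoc, LeftComodule.coassoc]
  counit_coact := by
    have h1 : (TensorProduct.lid k (M ⊗[k] N)).toLinearMap ∘ₗ
        Coalgebra.counit.rTensor (M ⊗[k] N) ∘ₗ mulLegs k H M N =
        TensorProduct.map
          ((TensorProduct.lid k M).toLinearMap ∘ₗ Coalgebra.counit.rTensor M)
          ((TensorProduct.lid k N).toLinearMap ∘ₗ Coalgebra.counit.rTensor N) := by
      ext a m b n
      simp [TensorProduct.smul_tmul', mul_smul]
      simp [TensorProduct.smul_tmul, smul_smul, mul_comm]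
    rw [← LinearMap.comp_assoc, ← LinearMap.comp_assoc,
      LinearMap.comp_assoc _ _ (TensorProduct.lid k (M ⊗[k] N)).toLinearMap, h1,
      ← TensorProduct.map_comp, LinearMap.comp_assoc, LinearMap.comp_assoc,
      LeftComodule.counit_coact, LeftComodule.counit_coact, TensorProduct.map_id]

end Tensor

/-! ### The universal grading group of the category of comodules -/

/-- A simple left `H`-comodule. -/
structure SimpleComodule (k : Type u) (H : Type v) [Field k] [Ring H] [Bialgebra k H] where
  /-- the underlying vector space -/
  carrier : Type v
  [addCommGroup : AddCommGroup carrier]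
  [module : Module k carrier]
  [comodule : LeftComodule k H carrier]
  isSimple : IsSimpleComodule k H carrier

attribute [instance] SimpleComodule.addCommGroup SimpleComodule.module SimpleComodule.comodule

/-- The relations between the generators `g_X`, where `X` is a simple comodule. In the last one,
`X` and `Y` are simple subquotients of the same indecomposable comodule, that is, they have to lie
in the same component of every decomposition of the category of comodules. -/
inductive GradingRelation (k : Type u) (H : Type v) [Field k] [Ring H] [Bialgebra k H] :
    FreeGroup (SimpleComodule k H) → Prop
  | iso (X Y : SimpleComodule k H) (f : X.carrier ≃ₗ[k] Y.carrier)
      (hf : IsComoduleHom k H f.toLinearMap) :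
      GradingRelation k H (FreeGroup.of X * (FreeGroup.of Y)⁻¹)
  | unit (X : SimpleComodule k H) (f : X.carrier ≃ₗ[k] k)
      (hf : IsComoduleHom k H f.toLinearMap) :
      GradingRelation k H (FreeGroup.of X)
  | tensor (X Y Z : SimpleComodule k H)
      (hZ : IsSubquotient k H Z.carrier (X.carrier ⊗[k] Y.carrier)) :
      GradingRelation k H (FreeGroup.of X * FreeGroup.of Y * (FreeGroup.of Z)⁻¹)
  | linked (X Y : SimpleComodule k H) (E : Type v) [AddCommGroup E] [Module k E]
      [LeftComodule k H E] (hE : IsIndecomposableComodule k H E)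
      (hX : IsSubquotient k H X.carrier E) (hY : IsSubquotient k H Y.carrier E) :
      GradingRelation k H (FreeGroup.of X * (FreeGroup.of Y)⁻¹)

/-- The universal grading group `U(H)` of the category of left `H`-comodules. -/
abbrev UniversalGradingGroup (k : Type u) (H : Type v) [Field k] [Ring H] [Bialgebra k H] :=
  PresentedGroup {w | GradingRelation k H w}

/-- The generator `g_X` of the universal grading group. -/
def gradeOf (k : Type u) (H : Type v) [Field k] [Ring H] [Bialgebra k H]
    (X : SimpleComodule k H) : UniversalGradingGroup k H :=
  PresentedGroup.of X

/-! ### Cocentral maps and the Hopf cocenter -/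

/-- A bialgebra map `π` is cocentral: `(id ⊗ π) ∘ Δ = (id ⊗ π) ∘ Δᵒᵖ`. -/
def IsCocentral {k : Type u} {H : Type v} {K : Type w} [Field k] [Ring H] [Bialgebra k H]
    [Ring K] [Bialgebra k K] (π : H →ₐc[k] K) : Prop :=
  (π : H →ₗ[k] K).lTensor H ∘ₗ Coalgebra.comul =
    (π : H →ₗ[k] K).lTensor H ∘ₗ (TensorProduct.comm k H H).toLinearMap ∘ₗ Coalgebra.comul

/-- `p : H → C` is the Hopf cocenter of `H`: it is a cocentral epimorphism of Hopf algebras and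
every cocentral map of Hopf algebras `H → K` factors uniquely through `p`. -/
def IsHopfCocenter {k : Type u} {H C : Type v} [Field k] [Ring H] [HopfAlgebra k H]
    [Ring C] [HopfAlgebra k C] (p : H →ₐc[k] C) : Prop :=
  IsCocentral p ∧ Function.Surjective p ∧
    ∀ (K : Type v) [Ring K] [HopfAlgebra k K] (π : H →ₐc[k] K), IsCocentral π →
      ∃! f : C →ₐc[k] K, f.comp p = π

/-! ### Yetter–Drinfeld modules over a group algebra -/

section GroupAction

variable (k : Type u) (Γ : Type v) [Field k] [Group Γ] (V : Type w) [AddCommGroup V] [Module k V]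
  [DistribMulAction Γ V] [SMulCommClass Γ k V]

/-- The action of the group algebra on a `Γ`-module. -/
def groupAction : MonoidAlgebra k Γ →ₐ[k] Module.End k V :=
  MonoidAlgebra.lift k (Module.End k V) Γ (DistribMulAction.toModuleEnd k V)


@[simp] lemma groupAction_single (g : Γ) (r : k) (x : V) :
    groupAction k Γ V (MonoidAlgebra.single g r) x = r • g • x := by
  simp [groupAction]

end GroupAction

section YetterDrinfeld

variable (k : Type u) (Γ : Type v) [Field k] [Group Γ]

/-- The linear map `a ↦ g a g⁻¹` of the group algebra. -/
def conj (g : Γ) : MonoidAlgebra k Γ →ₗ[k] MonoidAlgebra k Γ :=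
  LinearMap.mulLeft k (MonoidAlgebra.single g 1) ∘ₗ
    LinearMap.mulRight k (MonoidAlgebra.single g⁻¹ 1)

lemma conj_single (g h : Γ) (r : k) :
    conj k Γ g (MonoidAlgebra.single h r) = MonoidAlgebra.single (g * h * g⁻¹) r := by
  simp [conj, MonoidAlgebra.single_mul_single, mul_assoc]

/-- A left-left Yetter–Drinfeld module over the group algebra of `Γ`: a vector space with a linear
action and a coaction such that `ρ(g • x) = g x₍₋₁₎ g⁻¹ ⊗ g • x₍₀₎`. -/
class YetterDrinfeld (V : Type w) [AddCommGroup V] [Module k V] [DistribMulAction Γ V]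
    [SMulCommClass Γ k V] [LeftComodule k (MonoidAlgebra k Γ) V] : Prop where
  coact_smul : ∀ (g : Γ) (x : V), coact k (MonoidAlgebra k Γ) (g • x) =
    TensorProduct.map (conj k Γ g) (DistribSMul.toLinearMap k V g)
      (coact k (MonoidAlgebra k Γ) x)

/-- `x` is homogeneous of degree `g`: `ρ(x) = g ⊗ x`. -/
def IsHomogeneous {V : Type w} [AddCommGroup V] [Module k V]
    [LeftComodule k (MonoidAlgebra k Γ) V] (g : Γ) (x : V) : Prop :=
  coact k (MonoidAlgebra k Γ) x = MonoidAlgebra.single g (1 : k) ⊗ₜ[k] x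

variable (V : Type w) [AddCommGroup V] [Module k V] [DistribMulAction Γ V]
  [SMulCommClass Γ k V] [LeftComodule k (MonoidAlgebra k Γ) V] [YetterDrinfeld k Γ V]

/-- The support of `V`: the subgroup of `Γ` generated by the degrees of the nonzero homogeneous
elements of `V`. -/
def supp : Subgroup Γ :=
  Subgroup.closure {g | ∃ x : V, x ≠ 0 ∧ IsHomogeneous k Γ g x}

variable {k Γ V} in
lemma IsHomogeneous.smul {h : Γ} {x : V} (hx : IsHomogeneous k Γ h x) (g : Γ) :
    IsHomogeneous k Γ (g * h * g⁻¹) (g • x) := by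
  unfold IsHomogeneous at *
  rw [YetterDrinfeld.coact_smul, hx]
  simp [conj_single]

instance supp_normal : (supp k Γ V).Normal := by
  refine ⟨fun n hn g ↦ ?_⟩
  induction hn using Subgroup.closure_induction with
  | mem y hy =>
    obtain ⟨x, hx0, hx⟩ := hy
    exact Subgroup.subset_closure ⟨g • x, (smul_ne_zero_iff_ne g).2 hx0, hx.smul g⟩
  | one => simp
  | mul a b _ _ ha hb => simpa [mul_assoc] using (supp k Γ V).mul_mem ha hb
  | inv a _ ha => simpa [mul_assoc] using (supp k Γ V).inv_mem ha

/-- The braiding `V ⊗ W → W ⊗ V`, `x ⊗ y ↦ x₍₋₁₎ • y ⊗ x₍₀₎`, of the category of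
Yetter–Drinfeld modules. -/
def braiding (W : Type*) [AddCommGroup W] [Module k W] [DistribMulAction Γ W]
    [SMulCommClass Γ k W] : V ⊗[k] W →ₗ[k] W ⊗[k] V :=
  (TensorProduct.lift (groupAction k Γ W).toLinearMap).rTensor V ∘ₗ
    (TensorProduct.rightComm k (MonoidAlgebra k Γ) V W).toLinearMap ∘ₗ
    (coact k (MonoidAlgebra k Γ)).rTensor W

variable {k Γ V} in
lemma IsHomogeneous.braiding {W : Type*} [AddCommGroup W] [Module k W] [DistribMulAction Γ W]
    [SMulCommClass Γ k W] {g : Γ} {x : V} (hx : IsHomogeneous k Γ g x) (y : W) :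
    braiding k Γ V W (x ⊗ₜ y) = (g • y) ⊗ₜ x := by
  unfold IsHomogeneous at hx
  simp [ZestingHopf.braiding, hx]

end YetterDrinfeld

section Homogeneous

variable (k : Type u) {Γ : Type v} [Field k] [Group Γ]

/-- The coefficient of `g` in an element of `k[Γ] ⊗ V`. -/
def coeffAt (V : Type*) [AddCommGroup V] [Module k V] (g : Γ) :
    MonoidAlgebra k Γ ⊗[k] V →ₗ[k] V :=
  (TensorProduct.lid k V).toLinearMap ∘ₗ
    ((Finsupp.lapply g : (Γ →₀ k) →ₗ[k] k) ∘ₗ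
      (MonoidAlgebra.coeffLinearEquiv k : MonoidAlgebra k Γ ≃ₗ[k] (Γ →₀ k)).toLinearMap).rTensor V

@[simp] lemma coeffAt_tmul (V : Type*) [AddCommGroup V] [Module k V] (g : Γ)
    (a : MonoidAlgebra k Γ) (x : V) : coeffAt k V g (a ⊗ₜ x) = a.coeff g • x := by
  simp [coeffAt, MonoidAlgebra.coeffLinearEquiv]
  try rfl

lemma isHomogeneous_coeffAt {V : Type*} [AddCommGroup V] [Module k V]
    [LeftComodule k (MonoidAlgebra k Γ) V] (g : Γ) (x : V) :
    IsHomogeneous k Γ g (coeffAt k V g (coact k (MonoidAlgebra k Γ) x)) := by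
  have h1 : ∀ t : MonoidAlgebra k Γ ⊗[k] V, coact k (MonoidAlgebra k Γ) (coeffAt k V g t) =
      coeffAt k _ g ((coact k (MonoidAlgebra k Γ)).lTensor _ t) := by
    intro t
    induction t with
    | zero => simp
    | add a b ha hb => simp only [map_add, ha, hb]
    | tmul a y => simp
  have h2 : ∀ t : MonoidAlgebra k Γ ⊗[k] V,
      coeffAt k _ g (TensorProduct.assoc k _ _ V (Coalgebra.comul.rTensor V t)) =
      MonoidAlgebra.single g (1 : k) ⊗ₜ[k] coeffAt k V g t := by
    intro t
    induction t with
    | zero => simp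
    | add a b ha hb => simp only [map_add, TensorProduct.tmul_add, ha, hb]
    | tmul a y =>
      induction a using MonoidAlgebra.induction_linear with
      | zero => simp
      | add a b ha hb => simp only [map_add, TensorProduct.add_tmul, TensorProduct.tmul_add, ha, hb]
      | single h r =>
        rcases eq_or_ne g h with rfl | hh
        · simp [MonoidAlgebra.comul_single, MonoidAlgebra.coeff_single, TensorProduct.smul_tmul']
        · simp [MonoidAlgebra.comul_single, MonoidAlgebra.coeff_single,
            Finsupp.single_eq_of_ne hh]
  have h3 := LinearMap.congr_fun (LeftComodule.coassoc (k := k) (C := MonoidAlgebra k Γ) (M := V)) x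
  simp only [LinearMap.comp_apply, LinearEquiv.coe_coe] at h3
  unfold IsHomogeneous
  rw [h1, ← h3, h2]

/-- To prove an additive property of all elements of a comodule over a group algebra, it suffices to
consider homogeneous elements. -/
lemma homogeneous_induction {V : Type*} [AddCommGroup V] [Module k V]
    [LeftComodule k (MonoidAlgebra k Γ) V] {p : V → Prop} (zero : p 0)
    (add : ∀ x y, p x → p y → p (x + y))
    (homog : ∀ (g : Γ) (x : V), IsHomogeneous k Γ g x → p x) (x : V) : p x := by
  classical
  have h : ∀ t : MonoidAlgebra k Γ ⊗[k] V, ∃ s : Finset Γ, ∀ s' : Finset Γ, s ⊆ s' →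
      TensorProduct.lid k V (Coalgebra.counit.rTensor V t) = ∑ g ∈ s', coeffAt k V g t := by
    intro t
    induction t with
    | zero => exact ⟨∅, by simp⟩
    | add a b ha hb =>
      obtain ⟨s, hs⟩ := ha
      obtain ⟨s', hs'⟩ := hb
      refine ⟨s ∪ s', fun r hr ↦ ?_⟩
      simp only [map_add, Finset.sum_add_distrib]
      rw [hs r (Finset.union_subset_left hr), hs' r (Finset.union_subset_right hr)]
    | tmul a y =>
      induction a using MonoidAlgebra.induction_linear with
      | zero => exact ⟨∅, by simp⟩
      | add a b ha hb =>
        obtain ⟨s, hs⟩ := ha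
        obtain ⟨s', hs'⟩ := hb
        refine ⟨s ∪ s', fun r hr ↦ ?_⟩
        simp only [TensorProduct.add_tmul, map_add, Finset.sum_add_distrib]
        rw [hs r (Finset.union_subset_left hr), hs' r (Finset.union_subset_right hr)]
      | single h r =>
        refine ⟨{h}, fun s hs ↦ ?_⟩
        rw [Finset.sum_eq_single h]
        · simp [MonoidAlgebra.counit_single, MonoidAlgebra.coeff_single]
        · intro g _ hg
          simp [MonoidAlgebra.coeff_single, hg.symm]
        · intro hh
          exact absurd (hs (by simp)) hh
  obtain ⟨s, hs⟩ := h (coact k (MonoidAlgebra k Γ) x)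
  have hx := LinearMap.congr_fun
    (LeftComodule.counit_coact (k := k) (C := MonoidAlgebra k Γ) (M := V)) x
  simp only [LinearMap.comp_apply, LinearEquiv.coe_coe, LinearMap.id_apply] at hx
  rw [← hx, hs s subset_rfl]
  exact Finset.sum_induction _ p add zero fun g _ ↦ homog g _ (isHomogeneous_coeffAt k g x)

/-- Two linear maps which agree on homogeneous elements are equal. -/
lemma linearMap_ext_homogeneous {V W : Type*} [AddCommGroup V] [Module k V]
    [LeftComodule k (MonoidAlgebra k Γ) V] [AddCommGroup W] [Module k W] {f f' : V →ₗ[k] W}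
    (h : ∀ (g : Γ) (x : V), IsHomogeneous k Γ g x → f x = f' x) : f = f' := by
  refine LinearMap.ext fun x ↦ homogeneous_induction (k := k) (Γ := Γ)
    (p := fun x ↦ f x = f' x) (by simp) (fun x y hx hy ↦ by simp [hx, hy]) h x

/-- Two linear maps on a tensor product which agree on tensors of homogeneous elements are equal. -/
lemma tensor_ext_homogeneous {V V' W : Type*} [AddCommGroup V] [Module k V]
    [LeftComodule k (MonoidAlgebra k Γ) V] [AddCommGroup V'] [Module k V']
    [LeftComodule k (MonoidAlgebra k Γ) V'] [AddCommGroup W] [Module k W]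
    {f f' : V ⊗[k] V' →ₗ[k] W}
    (h : ∀ (g g' : Γ) (x : V) (y : V'), IsHomogeneous k Γ g x → IsHomogeneous k Γ g' y →
      f (x ⊗ₜ y) = f' (x ⊗ₜ y)) : f = f' := by
  refine TensorProduct.ext (linearMap_ext_homogeneous k (Γ := Γ) fun g x hx ↦
    linearMap_ext_homogeneous k (Γ := Γ) fun g' y hy ↦ ?_)
  exact h g g' x y hx hy

variable {k} in
lemma IsHomogeneous.tmul {V V' : Type*} [AddCommGroup V] [Module k V]
    [LeftComodule k (MonoidAlgebra k Γ) V] [AddCommGroup V'] [Module k V']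
    [LeftComodule k (MonoidAlgebra k Γ) V'] {g g' : Γ} {x : V} {y : V'}
    (hx : IsHomogeneous k Γ g x) (hy : IsHomogeneous k Γ g' y) :
    IsHomogeneous k Γ (g * g') (x ⊗ₜ[k] y) := by
  unfold IsHomogeneous at *
  change mulLegs k _ _ _ (coact k (MonoidAlgebra k Γ) x ⊗ₜ coact k (MonoidAlgebra k Γ) y) = _
  rw [hx, hy, mulLegs_tmul, MonoidAlgebra.single_mul_single, one_mul]

variable {k} in
lemma IsHomogeneous.map {V V' : Type*} [AddCommGroup V] [Module k V]
    [LeftComodule k (MonoidAlgebra k Γ) V] [AddCommGroup V'] [Module k V']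
    [LeftComodule k (MonoidAlgebra k Γ) V'] {f : V →ₗ[k] V'}
    (hf : IsComoduleHom k (MonoidAlgebra k Γ) f) {g : Γ} {x : V} (hx : IsHomogeneous k Γ g x) :
    IsHomogeneous k Γ g (f x) := by
  unfold IsHomogeneous at *
  have h := LinearMap.congr_fun hf x
  rw [LinearMap.comp_apply, LinearMap.comp_apply, hx, LinearMap.lTensor_tmul] at h
  exact h

end Homogeneous

/-! ### Braided Hopf algebras and pre-Nichols algebras -/

/-- The multiplication of the braided tensor product `B ⊗ B`:
`(a ⊗ b) (c ⊗ d) = a (b₍₋₁₎ • c) ⊗ b₍₀₎ d`. -/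
def braidedMul (k : Type u) (Γ : Type v) (B : Type w) [Field k] [Group Γ] [Ring B] [Algebra k B]
    [MulSemiringAction Γ B] [SMulCommClass Γ k B] [LeftComodule k (MonoidAlgebra k Γ) B] :
    (B ⊗[k] B) ⊗[k] (B ⊗[k] B) →ₗ[k] B ⊗[k] B :=
  TensorProduct.map (LinearMap.mul' k B) (LinearMap.mul' k B) ∘ₗ
    (TensorProduct.tensorTensorTensorAssoc k B B B B).symm.toLinearMap ∘ₗ
    ((braiding k Γ B B).lTensor B).rTensor B ∘ₗ
    (TensorProduct.tensorTensorTensorAssoc k B B B B).toLinearMap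

/-- A Hopf algebra in the braided category of Yetter–Drinfeld modules over the group algebra of
`Γ`: the unit, the multiplication, the counit and the comultiplication are maps of
Yetter–Drinfeld modules, the counit is multiplicative, the comultiplication is multiplicative with
respect to the braided tensor product, and there is an antipode. (The action of `Γ` by ring
automorphisms expresses that the unit and the multiplication are `Γ`-equivariant.) -/
class BraidedHopfAlgebra (k : Type u) (Γ : Type v) (B : Type w) [Field k] [Group Γ] [Ring B]
    [Algebra k B] [Coalgebra k B] [MulSemiringAction Γ B] [SMulCommClass Γ k B]
    [LeftComodule k (MonoidAlgebra k Γ) B] extends YetterDrinfeld k Γ B where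
  coact_one : coact k (MonoidAlgebra k Γ) (1 : B) = 1 ⊗ₜ 1
  coact_mul : ∀ a b : B, coact k (MonoidAlgebra k Γ) (a * b) =
    coact k (MonoidAlgebra k Γ) a * coact k (MonoidAlgebra k Γ) b
  counit_smul : ∀ (g : Γ) (b : B), Coalgebra.counit (R := k) (g • b) = Coalgebra.counit (R := k) b
  comul_smul : ∀ (g : Γ) (b : B), Coalgebra.comul (R := k) (g • b) =
    TensorProduct.map (DistribSMul.toLinearMap k B g) (DistribSMul.toLinearMap k B g)
      (Coalgebra.comul (R := k) b)
  isComoduleHom_counit : IsComoduleHom k (MonoidAlgebra k Γ) (Coalgebra.counit : B →ₗ[k] k)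
  isComoduleHom_comul : IsComoduleHom k (MonoidAlgebra k Γ) (Coalgebra.comul : B →ₗ[k] B ⊗[k] B)
  counit_one : Coalgebra.counit (R := k) (1 : B) = 1
  counit_mul : ∀ a b : B, Coalgebra.counit (R := k) (a * b) =
    Coalgebra.counit (R := k) a * Coalgebra.counit (R := k) b
  comul_one : Coalgebra.comul (R := k) (1 : B) = 1 ⊗ₜ 1
  comul_mul : ∀ a b : B, Coalgebra.comul (R := k) (a * b) =
    braidedMul k Γ B (Coalgebra.comul (R := k) a ⊗ₜ Coalgebra.comul (R := k) b)
  /-- the antipode -/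
  braidedAntipode : B →ₗ[k] B
  mul_antipode_rTensor_comul : LinearMap.mul' k B ∘ₗ braidedAntipode.rTensor B ∘ₗ
    Coalgebra.comul = Algebra.linearMap k B ∘ₗ Coalgebra.counit
  mul_antipode_lTensor_comul : LinearMap.mul' k B ∘ₗ braidedAntipode.lTensor B ∘ₗ
    Coalgebra.comul = Algebra.linearMap k B ∘ₗ Coalgebra.counit

/-- The structure of a pre-Nichols algebra of `V` on a braided Hopf algebra `B`: an `ℕ`-grading of
`B` as a Hopf algebra in the category of Yetter–Drinfeld modules, with `B⁰ = k`, and an isomorphism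
of Yetter–Drinfeld modules of `V` with `B¹`, such that `B¹` generates `B` as an algebra.
Equivalently, `B` is a graded Hopf algebra quotient `T(V) → B` of the tensor algebra, bijective in
degrees `0` and `1`, and so lies between `T(V)` and the Nichols algebra of `V`. -/
structure PreNicholsAlgebra (k : Type u) (Γ : Type v) (V : Type*) (B : Type w) [Field k] [Group Γ]
    [AddCommGroup V] [Module k V] [DistribMulAction Γ V] [SMulCommClass Γ k V]
    [LeftComodule k (MonoidAlgebra k Γ) V] [YetterDrinfeld k Γ V]
    [Ring B] [Algebra k B] [Coalgebra k B] [MulSemiringAction Γ B] [SMulCommClass Γ k B]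
    [LeftComodule k (MonoidAlgebra k Γ) B] [BraidedHopfAlgebra k Γ B] where
  /-- the homogeneous components -/
  deg : ℕ → Submodule k B
  isInternal : DirectSum.IsInternal deg
  mul_mem : ∀ (m n : ℕ) (a b : B), a ∈ deg m → b ∈ deg n → a * b ∈ deg (m + n)
  comul_mem : ∀ (n : ℕ) (b : B), b ∈ deg n → Coalgebra.comul (R := k) b ∈
    ⨆ p ∈ Finset.HasAntidiagonal.antidiagonal n,
      LinearMap.range (TensorProduct.map (deg p.1).subtype (deg p.2).subtype)
  counit_eq_zero : ∀ (n : ℕ) (b : B), n ≠ 0 → b ∈ deg n → Coalgebra.counit (R := k) b = 0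
  smul_mem : ∀ (n : ℕ) (g : Γ) (b : B), b ∈ deg n → g • b ∈ deg n
  isSubcomodule : ∀ n : ℕ, IsSubcomodule k (MonoidAlgebra k Γ) (deg n)
  deg_zero : deg 0 = Submodule.span k {1}
  /-- the embedding of `V` as the component of degree one -/
  incl : V →ₗ[k] B
  incl_injective : Function.Injective incl
  range_incl : LinearMap.range incl = deg 1
  incl_smul : ∀ (g : Γ) (x : V), incl (g • x) = g • incl x
  isComoduleHom_incl : IsComoduleHom k (MonoidAlgebra k Γ) incl
  adjoin_eq_top : Algebra.adjoin k (Set.range incl) = ⊤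

/-! ### The bosonization -/

section Bosonization

/-- The underlying algebra of the bosonization `B # kΓ`. The element `b # g` is
`SkewMonoidAlgebra.single g b`, and `(b # g) (c # h) = b (g • c) # g h`. -/
abbrev Bosonization (Γ : Type v) (B : Type w) [Ring B] := SkewMonoidAlgebra B Γ

namespace Bosonization

open SkewMonoidAlgebra (single lsingle single_mul_single)

variable (k : Type u) (Γ : Type v) (B : Type w) [Field k] [Group Γ] [Ring B]
    [Algebra k B] [MulSemiringAction Γ B] [SMulCommClass Γ k B]

/-- The algebra map `kΓ → B # kΓ`, `g ↦ 1 # g`. -/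
def ofGroup : MonoidAlgebra k Γ →ₐ[k] Bosonization Γ B :=
  MonoidAlgebra.lift k (Bosonization Γ B) Γ
    { toFun := fun g ↦ single g 1
      map_one' := rfl
      map_mul' := fun g h ↦ by simp }

@[simp] lemma ofGroup_single (g : Γ) (r : k) :
    ofGroup k Γ B (MonoidAlgebra.single g r) = r • single g (1 : B) := by
  simp [ofGroup]

lemma lsingle_eq (g : Γ) (b : B) : lsingle k g b = (single g b : Bosonization Γ B) := rfl

/-- `b ⊗ a ↦ (b # 1) (1 # a) = b # a`. -/
def smash : B ⊗[k] MonoidAlgebra k Γ →ₗ[k] Bosonization Γ B :=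
  LinearMap.mul' k (Bosonization Γ B) ∘ₗ
    TensorProduct.map (lsingle k 1) (ofGroup k Γ B).toLinearMap

lemma smash_tmul_single (b : B) (g : Γ) (r : k) :
    smash k Γ B (b ⊗ₜ MonoidAlgebra.single g r) = r • single g b := by
  simp [smash, lsingle_eq]

/-- The map `b ⊗ w ↦ (b # w₍₋₁₎) ⊗ φ(w₍₀₎)`. -/
def twist {W X : Type*} [AddCommGroup W] [Module k W] [LeftComodule k (MonoidAlgebra k Γ) W]
    [AddCommGroup X] [Module k X] (φ : W →ₗ[k] X) : B ⊗[k] W →ₗ[k] Bosonization Γ B ⊗[k] X :=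
  TensorProduct.map (smash k Γ B) φ ∘ₗ
    (TensorProduct.assoc k B (MonoidAlgebra k Γ) W).symm.toLinearMap ∘ₗ
    (coact k (MonoidAlgebra k Γ)).lTensor B

lemma twist_tmul {W X : Type*} [AddCommGroup W] [Module k W]
    [LeftComodule k (MonoidAlgebra k Γ) W] [AddCommGroup X] [Module k X] (φ : W →ₗ[k] X)
    (b : B) {g : Γ} {w : W} (hw : IsHomogeneous k Γ g w) :
    twist k Γ B φ (b ⊗ₜ w) = single g b ⊗ₜ φ w := by
  unfold IsHomogeneous at hw
  simp [twist, hw, smash_tmul_single]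

lemma algHom_ext {A : Type*} [Semiring A] [Algebra k A] {f f' : Bosonization Γ B →ₐ[k] A}
    (h : ∀ b, f (single 1 b) = f' (single 1 b)) (h' : ∀ g, f (single g 1) = f' (single g 1)) :
    f = f' := by
  have key : ∀ (g : Γ) (b : B), f (single g b) = f' (single g b) := by
    intro g b
    have : (single g b : Bosonization Γ B) = single 1 b * single g 1 := by simp
    rw [this, map_mul, map_mul, h, h']
  refine AlgHom.toLinearMap_injective (SkewMonoidAlgebra.lhom_ext fun g b ↦ key g b)

variable [Coalgebra k B] [LeftComodule k (MonoidAlgebra k Γ) B] [BraidedHopfAlgebra k Γ B]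

/-- `a ⊗ b ↦ (a # b₍₋₁₎) ⊗ (b₍₀₎ # 1)`. -/
def split : B ⊗[k] B →ₗ[k] Bosonization Γ B ⊗[k] Bosonization Γ B :=
  twist k Γ B (lsingle k 1)

lemma split_tmul (a : B) {g : Γ} {b : B} (hb : IsHomogeneous k Γ g b) :
    split k Γ B (a ⊗ₜ b) = single g a ⊗ₜ single 1 b :=
  twist_tmul k Γ B _ a hb

lemma braidedMul_tmul (a : B) {g : Γ} {b : B} (hb : IsHomogeneous k Γ g b) (c d : B) :
    braidedMul k Γ B ((a ⊗ₜ b) ⊗ₜ (c ⊗ₜ d)) = (a * g • c) ⊗ₜ (b * d) := by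
  simp [braidedMul, hb.braiding]

lemma IsHomogeneous.mul {a b : B} {g h : Γ} (ha : IsHomogeneous k Γ g a)
    (hb : IsHomogeneous k Γ h b) : IsHomogeneous k Γ (g * h) (a * b) := by
  unfold IsHomogeneous at *
  rw [BraidedHopfAlgebra.coact_mul, ha, hb]
  simp [MonoidAlgebra.single_mul_single]

lemma split_braidedMul (s t : B ⊗[k] B) :
    split k Γ B (braidedMul k Γ B (s ⊗ₜ t)) = split k Γ B s * split k Γ B t := by
  have : (split k Γ B) ∘ₗ braidedMul k Γ B =
      LinearMap.mul' k (Bosonization Γ B ⊗[k] Bosonization Γ B) ∘ₗ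
        TensorProduct.map (split k Γ B) (split k Γ B) := by
    refine TensorProduct.ext (tensor_ext_homogeneous k (Γ := Γ) fun g h a b ha hb ↦
      tensor_ext_homogeneous k (Γ := Γ) fun g' h' c d hc hd ↦ ?_)
    simp [braidedMul_tmul k Γ B a hb c d, split_tmul k Γ B _ hb, split_tmul k Γ B _ hd,
      split_tmul k Γ B _ (IsHomogeneous.mul k Γ B hb hd)]
  exact LinearMap.congr_fun this (s ⊗ₜ t)

lemma isHomogeneous_one : IsHomogeneous k Γ (1 : Γ) (1 : B) :=
  BraidedHopfAlgebra.coact_one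

/-- The comultiplication of the bosonization on `B`: `b ↦ (b₍₁₎ # b₍₂₎₍₋₁₎) ⊗ (b₍₂₎₍₀₎ # 1)`. -/
def comulB : B →ₐ[k] Bosonization Γ B ⊗[k] Bosonization Γ B :=
  AlgHom.ofLinearMap (split k Γ B ∘ₗ Coalgebra.comul)
    (by
      rw [LinearMap.comp_apply, BraidedHopfAlgebra.comul_one (k := k) (Γ := Γ),
        split_tmul k Γ B _ (isHomogeneous_one k Γ B)]
      rfl)
    (fun a b ↦ by
      rw [LinearMap.comp_apply, BraidedHopfAlgebra.comul_mul (k := k) (Γ := Γ),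
        split_braidedMul]
      rfl)

@[simp] lemma comulB_apply (b : B) : comulB k Γ B b = split k Γ B (Coalgebra.comul b) := rfl

/-- The comultiplication of the bosonization on `Γ`: `g ↦ g ⊗ g`. -/
def comulΓ : Γ →* Bosonization Γ B ⊗[k] Bosonization Γ B where
  toFun g := single g 1 ⊗ₜ single g 1
  map_one' := rfl
  map_mul' g h := by simp

@[simp] lemma comulΓ_apply (g : Γ) : comulΓ k Γ B g = single g 1 ⊗ₜ single g 1 := rfl

lemma comulB_comulΓ (g : Γ) (b : B) :
    comulB k Γ B (g • b) * comulΓ k Γ B g = comulΓ k Γ B g * comulB k Γ B b := by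
  have : LinearMap.mulRight k (comulΓ k Γ B g) ∘ₗ split k Γ B ∘ₗ
      TensorProduct.map (DistribSMul.toLinearMap k B g) (DistribSMul.toLinearMap k B g) =
      LinearMap.mulLeft k (comulΓ k Γ B g) ∘ₗ split k Γ B := by
    refine tensor_ext_homogeneous k (Γ := Γ) fun h h' a b ha hb ↦ ?_
    simp [split_tmul k Γ B _ hb, split_tmul k Γ B _ (hb.smul g)]
  simpa [BraidedHopfAlgebra.comul_smul (k := k) g b] using
    LinearMap.congr_fun this (Coalgebra.comul b)

/-- The comultiplication `b # g ↦ (b₍₁₎ # b₍₂₎₍₋₁₎ g) ⊗ (b₍₂₎₍₀₎ # g)` of the bosonization. -/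
def comulHom : Bosonization Γ B →ₐ[k] Bosonization Γ B ⊗[k] Bosonization Γ B :=
  SkewMonoidAlgebra.liftNCAlgHom (comulB k Γ B) (comulΓ k Γ B)
    (fun {b g} ↦ comulB_comulΓ k Γ B g b)

lemma comulHom_single (g : Γ) (b : B) : comulHom k Γ B (single g b) =
    split k Γ B (Coalgebra.comul b) * (single g 1 ⊗ₜ single g 1) := by
  simp [comulHom, SkewMonoidAlgebra.liftNCAlgHom, SkewMonoidAlgebra.liftNCRingHom]

/-- The counit of `B` as an algebra map. -/
def counitB : B →ₐ[k] k :=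
  AlgHom.ofLinearMap Coalgebra.counit (BraidedHopfAlgebra.counit_one Γ)
    (BraidedHopfAlgebra.counit_mul Γ)

@[simp] lemma counitB_apply (b : B) : counitB k Γ B b = Coalgebra.counit b := rfl

/-- The counit `b # g ↦ ε(b)` of the bosonization. -/
def counitHom : Bosonization Γ B →ₐ[k] k :=
  SkewMonoidAlgebra.liftNCAlgHom (counitB k Γ B) (1 : Γ →* k)
    (fun {b g} ↦ by simp [BraidedHopfAlgebra.counit_smul])

lemma counitHom_single (g : Γ) (b : B) :
    counitHom k Γ B (single g b) = Coalgebra.counit b := by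
  simp [counitHom, SkewMonoidAlgebra.liftNCAlgHom, SkewMonoidAlgebra.liftNCRingHom]

lemma counit_eq_zero_of_ne {g : Γ} {b : B} (hb : IsHomogeneous k Γ g b) (hg : g ≠ 1) :
    Coalgebra.counit (R := k) b = 0 := by
  have h := hb.map (BraidedHopfAlgebra.isComoduleHom_counit (k := k) (Γ := Γ) (B := B))
  unfold IsHomogeneous at h
  have h' := congrArg (coeffAt k k g) h
  have h1 : coact k (MonoidAlgebra k Γ) (Coalgebra.counit (R := k) b : k) =
      1 ⊗ₜ (Coalgebra.counit (R := k) b : k) := rfl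
  rw [h1] at h'
  simpa [MonoidAlgebra.one_def, MonoidAlgebra.coeff_single, Finsupp.single_eq_of_ne hg,
    eq_comm] using h'

instance instBialgebra : Bialgebra k (Bosonization Γ B) :=
  Bialgebra.ofAlgHom (comulHom k Γ B) (counitHom k Γ B)
    (by
      refine algHom_ext k Γ B (fun b ↦ ?_) (fun g ↦ ?_)
      · let G : B ⊗[k] (B ⊗[k] B) →ₗ[k] _ := twist k Γ B (split k Γ B)
        have h1 : (TensorProduct.assoc k _ _ _).toLinearMap ∘ₗ
            (comulHom k Γ B).toLinearMap.rTensor _ ∘ₗ split k Γ B =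
            G ∘ₗ (TensorProduct.assoc k B B B).toLinearMap ∘ₗ Coalgebra.comul.rTensor B := by
          refine tensor_ext_homogeneous k (Γ := Γ) fun h g a c ha hc ↦ ?_
          have h2 : (TensorProduct.assoc k (Bosonization Γ B) (Bosonization Γ B)
              (Bosonization Γ B)).toLinearMap ∘ₗ
              (TensorProduct.mk k _ _).flip (single 1 c) ∘ₗ
              LinearMap.mulRight k (comulΓ k Γ B g) ∘ₗ split k Γ B =
              G ∘ₗ (TensorProduct.assoc k B B B).toLinearMap ∘ₗ
                (TensorProduct.mk k _ _).flip c := by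
            refine tensor_ext_homogeneous k (Γ := Γ) fun h' g' a' b' ha' hb' ↦ ?_
            simp [G, split_tmul k Γ B _ hb', split_tmul k Γ B _ hc,
              twist_tmul k Γ B _ _ (hb'.tmul hc)]
          have h3 := LinearMap.congr_fun h2 (Coalgebra.comul a)
          simp only [LinearMap.comp_apply, LinearMap.flip_apply, TensorProduct.mk_apply,
            LinearMap.mulRight_apply, LinearEquiv.coe_coe, comulΓ_apply] at h3
          simp only [LinearMap.comp_apply, split_tmul k Γ B _ hc, LinearMap.rTensor_tmul,
            LinearEquiv.coe_coe, AlgHom.toLinearMap_apply, comulHom_single, h3]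
        have h4 : (comulHom k Γ B).toLinearMap.lTensor _ ∘ₗ split k Γ B =
            G ∘ₗ Coalgebra.comul.lTensor B := by
          refine tensor_ext_homogeneous k (Γ := Γ) fun h g a b ha hb ↦ ?_
          have hb' := hb.map (BraidedHopfAlgebra.isComoduleHom_comul (k := k) (Γ := Γ) (B := B))
          simp [G, split_tmul k Γ B _ hb, twist_tmul k Γ B _ _ hb', comulHom_single,
            SkewMonoidAlgebra.single_one_one, ← Algebra.TensorProduct.one_def]
        have h5 := LinearMap.congr_fun h1 (Coalgebra.comul b)
        have h6 := LinearMap.congr_fun h4 (Coalgebra.comul b)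
        have h7 := LinearMap.congr_fun (Coalgebra.coassoc (R := k) (A := B)) b
        simp only [LinearMap.comp_apply, LinearEquiv.coe_coe] at h5 h6 h7
        rw [h7, ← h6] at h5
        have h8 : comulHom k Γ B (single 1 b) = split k Γ B (Coalgebra.comul b) := by
          rw [comulHom_single, ← SkewMonoidAlgebra.one_def, ← Algebra.TensorProduct.one_def,
            mul_one]
        simp only [AlgHom.comp_apply, h8]
        exact h5
      · simp [comulHom_single, BraidedHopfAlgebra.comul_one Γ,
          split_tmul k Γ B _ (isHomogeneous_one k Γ B)])
    (by
      refine algHom_ext k Γ B (fun b ↦ ?_) (fun g ↦ ?_)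
      · have h1 : (counitHom k Γ B).toLinearMap.rTensor _ ∘ₗ split k Γ B =
            (lsingle k 1).lTensor k ∘ₗ Coalgebra.counit.rTensor B := by
          refine tensor_ext_homogeneous k (Γ := Γ) fun h g a b ha hb ↦ ?_
          simp [lsingle_eq, split_tmul k Γ B _ hb, counitHom_single]
        have h2 := LinearMap.congr_fun h1 (Coalgebra.comul b)
        have h8 : comulHom k Γ B (single 1 b) = split k Γ B (Coalgebra.comul b) := by
          rw [comulHom_single, ← SkewMonoidAlgebra.one_def, ← Algebra.TensorProduct.one_def,
            mul_one]
        simp only [AlgHom.comp_apply, h8]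
        refine h2.trans ?_
        rw [LinearMap.comp_apply]
        simp [lsingle_eq]
      · simp [comulHom_single, BraidedHopfAlgebra.comul_one Γ, counitHom_single,
          split_tmul k Γ B _ (isHomogeneous_one k Γ B), BraidedHopfAlgebra.counit_one Γ])
    (by
      refine algHom_ext k Γ B (fun b ↦ ?_) (fun g ↦ ?_)
      · have h1 : (counitHom k Γ B).toLinearMap.lTensor _ ∘ₗ split k Γ B =
            (lsingle k 1).rTensor k ∘ₗ Coalgebra.counit.lTensor B := by
          refine tensor_ext_homogeneous k (Γ := Γ) fun h g a b ha hb ↦ ?_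
          rcases eq_or_ne g 1 with rfl | hg
          · simp [lsingle_eq, split_tmul k Γ B _ hb, counitHom_single]
          · simp [lsingle_eq, split_tmul k Γ B _ hb, counitHom_single, counit_eq_zero_of_ne k Γ B hb hg]
        have h2 := LinearMap.congr_fun h1 (Coalgebra.comul b)
        have h8 : comulHom k Γ B (single 1 b) = split k Γ B (Coalgebra.comul b) := by
          rw [comulHom_single, ← SkewMonoidAlgebra.one_def, ← Algebra.TensorProduct.one_def,
            mul_one]
        simp only [AlgHom.comp_apply, h8]
        refine h2.trans ?_
        rw [LinearMap.comp_apply]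
        simp [lsingle_eq]
      · simp [comulHom_single, BraidedHopfAlgebra.comul_one Γ, counitHom_single,
          split_tmul k Γ B _ (isHomogeneous_one k Γ B), BraidedHopfAlgebra.counit_one Γ])


lemma comul_single (g : Γ) (b : B) : Coalgebra.comul (R := k) (single g b : Bosonization Γ B) =
    split k Γ B (Coalgebra.comul b) * (single g 1 ⊗ₜ single g 1) :=
  comulHom_single k Γ B g b

lemma counit_single (g : Γ) (b : B) :
    Coalgebra.counit (R := k) (single g b : Bosonization Γ B) = Coalgebra.counit (R := k) b :=
  counitHom_single k Γ B g b

/-- The linear map `b ↦ (1 # g⁻¹ b₍₋₁₎⁻¹) (S(b₍₀₎) # 1)`. -/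
def antipodeAt (g : Γ) : B →ₗ[k] Bosonization Γ B :=
  LinearMap.mulLeft k (single g⁻¹ 1) ∘ₗ LinearMap.mul' k (Bosonization Γ B) ∘ₗ
    TensorProduct.map
      ((ofGroup k Γ B).toLinearMap ∘ₗ HopfAlgebra.antipode k (A := MonoidAlgebra k Γ))
      (lsingle k 1 ∘ₗ BraidedHopfAlgebra.braidedAntipode Γ) ∘ₗ
    coact k (MonoidAlgebra k Γ)

lemma antipodeAt_apply (g : Γ) {h : Γ} {b : B} (hb : IsHomogeneous k Γ h b) :
    antipodeAt k Γ B g b =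
      single g⁻¹ 1 * (single h⁻¹ 1 * single 1 (BraidedHopfAlgebra.braidedAntipode (k := k) Γ b)) := by
  unfold IsHomogeneous at hb
  simp only [antipodeAt, LinearMap.comp_apply, hb, TensorProduct.map_tmul, lsingle_eq,
    LinearMap.mul'_apply, LinearMap.mulLeft_apply, MonoidAlgebra.antipode_single,
    AlgHom.toLinearMap_apply, ofGroup_single, HopfAlgebra.antipode_one, one_smul]

/-- The antipode `b # g ↦ (1 # g⁻¹ b₍₋₁₎⁻¹) (S(b₍₀₎) # 1)` of the bosonization. -/
def antipodeMap : Bosonization Γ B →ₗ[k] Bosonization Γ B where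
  toFun x := x.sum fun g b ↦ antipodeAt k Γ B g b
  map_add' x y := SkewMonoidAlgebra.sum_add_index' (by simp) (by simp)
  map_smul' r x := by
    rw [SkewMonoidAlgebra.sum_smul_index' (by simp)]
    simp [SkewMonoidAlgebra.smul_sum]

lemma antipodeMap_single (g : Γ) (b : B) :
    antipodeMap k Γ B (single g b) = antipodeAt k Γ B g b :=
  SkewMonoidAlgebra.sum_single_index (by simp)

instance instHopfAlgebra : HopfAlgebra k (Bosonization Γ B) where
  antipode := antipodeMap k Γ B
  mul_antipode_rTensor_comul := by
    refine SkewMonoidAlgebra.lhom_ext' fun g ↦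
      linearMap_ext_homogeneous k (Γ := Γ) fun m b hb ↦ ?_
    let R : MonoidAlgebra k Γ ⊗[k] (B ⊗[k] B) →ₗ[k] Bosonization Γ B :=
      LinearMap.mulRight k (single g 1) ∘ₗ LinearMap.mulLeft k (single g⁻¹ 1) ∘ₗ
        LinearMap.mul' k (Bosonization Γ B) ∘ₗ TensorProduct.map
          ((ofGroup k Γ B).toLinearMap ∘ₗ HopfAlgebra.antipode k (A := MonoidAlgebra k Γ))
          (lsingle k 1 ∘ₗ LinearMap.mul' k B ∘ₗ
            (BraidedHopfAlgebra.braidedAntipode (k := k) Γ).rTensor B)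
    have hR : ∀ (m : Γ) (t : B ⊗[k] B), R (MonoidAlgebra.single m 1 ⊗ₜ t) =
        single g⁻¹ 1 * (single m⁻¹ 1 * single 1 (LinearMap.mul' k B
          ((BraidedHopfAlgebra.braidedAntipode (k := k) Γ).rTensor B t))) * single g 1 := by
      intro m t
      simp only [R, LinearMap.comp_apply, TensorProduct.map_tmul, lsingle_eq,
        LinearMap.mul'_apply, LinearMap.mulLeft_apply, LinearMap.mulRight_apply,
        MonoidAlgebra.antipode_single, AlgHom.toLinearMap_apply, ofGroup_single,
        HopfAlgebra.antipode_one, one_smul]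
    have h1 : LinearMap.mul' k (Bosonization Γ B) ∘ₗ (antipodeMap k Γ B).rTensor _ ∘ₗ
        LinearMap.mulRight k (comulΓ k Γ B g) ∘ₗ split k Γ B =
        R ∘ₗ coact k (MonoidAlgebra k Γ) := by
      refine tensor_ext_homogeneous k (Γ := Γ) fun p q x y hx hy ↦ ?_
      have hxy := hx.tmul hy
      unfold IsHomogeneous at hxy
      rw [LinearMap.comp_apply R, hxy, hR]
      simp [split_tmul k Γ B _ hy, antipodeMap_single, antipodeAt_apply k Γ B _ hx, mul_smul,
        mul_assoc]
    have h2 := LinearMap.congr_fun h1 (Coalgebra.comul b)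
    have h3 := LinearMap.congr_fun
      (BraidedHopfAlgebra.mul_antipode_rTensor_comul (k := k) (Γ := Γ) (B := B)) b
    have h4 := hb.map (BraidedHopfAlgebra.isComoduleHom_comul (k := k) (Γ := Γ) (B := B))
    unfold IsHomogeneous at h4
    simp only [LinearMap.comp_apply, LinearMap.mulRight_apply, comulΓ_apply] at h2 h3
    rw [h4, hR, h3] at h2
    simp only [LinearMap.comp_apply, lsingle_eq, comul_single, counit_single]
    rw [h2]
    rcases eq_or_ne m 1 with rfl | hm
    · simp only [Algebra.linearMap_apply, single_mul_single, inv_one, mul_one, one_mul,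
        smul_algebraMap, inv_mul_cancel, smul_one]
      rfl
    · simp [counit_eq_zero_of_ne k Γ B hb hm]
  mul_antipode_lTensor_comul := by
    refine SkewMonoidAlgebra.lhom_ext fun g b ↦ ?_
    have h1 : LinearMap.mul' k (Bosonization Γ B) ∘ₗ (antipodeMap k Γ B).lTensor _ ∘ₗ
        LinearMap.mulRight k (comulΓ k Γ B g) ∘ₗ split k Γ B = lsingle k 1 ∘ₗ
        LinearMap.mul' k B ∘ₗ (BraidedHopfAlgebra.braidedAntipode (k := k) Γ).lTensor B := by
      refine tensor_ext_homogeneous k (Γ := Γ) fun h h' a b ha hb ↦ ?_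
      simp [split_tmul k Γ B _ hb, antipodeMap_single, antipodeAt_apply k Γ B g hb, lsingle_eq,
        mul_smul]
    have h2 := LinearMap.congr_fun h1 (Coalgebra.comul b)
    have h3 := LinearMap.congr_fun
      (BraidedHopfAlgebra.mul_antipode_lTensor_comul (k := k) (Γ := Γ) (B := B)) b
    simp only [LinearMap.comp_apply, LinearMap.mulRight_apply, comulΓ_apply] at h2 h3
    simp only [LinearMap.comp_apply, comul_single, counit_single]
    rw [h2, h3]
    rfl

/-- The algebra map `b # g ↦ ε(b) g`. -/
def projHom : Bosonization Γ B →ₐ[k] MonoidAlgebra k Γ :=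
  SkewMonoidAlgebra.liftNCAlgHom
    ((Algebra.ofId k (MonoidAlgebra k Γ)).comp (counitB k Γ B)) (MonoidAlgebra.of k Γ)
    (fun {b g} ↦ by
      simp only [AlgHom.comp_apply, counitB_apply, BraidedHopfAlgebra.counit_smul]
      exact Algebra.commutes _ _)

lemma projHom_single (g : Γ) (b : B) :
    projHom k Γ B (single g b) = MonoidAlgebra.single g (Coalgebra.counit (R := k) b) := by
  simp [projHom, SkewMonoidAlgebra.liftNCAlgHom, SkewMonoidAlgebra.liftNCRingHom,
    Algebra.ofId_apply]

lemma single_one_eq_smul (r : k) :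
    (MonoidAlgebra.single 1 r : MonoidAlgebra k Γ) = r • 1 := by
  simp [MonoidAlgebra.one_def]

/-- The projection of Hopf algebras `B # kΓ → kΓ`, `b # g ↦ ε(b) g`. -/
def proj : Bosonization Γ B →ₐc[k] MonoidAlgebra k Γ :=
  BialgHom.ofAlgHom (projHom k Γ B)
    (by
      refine algHom_ext k Γ B (fun b ↦ ?_) (fun g ↦ ?_) <;>
      simp [projHom_single, counit_single])
    (by
      refine algHom_ext k Γ B (fun b ↦ ?_) (fun g ↦ ?_)
      · have h1 : TensorProduct.map (projHom k Γ B).toLinearMap (projHom k Γ B).toLinearMap ∘ₗ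
            split k Γ B = Algebra.linearMap k _ ∘ₗ Coalgebra.counit ∘ₗ
              (TensorProduct.lid k B).toLinearMap ∘ₗ Coalgebra.counit.rTensor B := by
          refine tensor_ext_homogeneous k (Γ := Γ) fun h g x y hx hy ↦ ?_
          rcases eq_or_ne g 1 with rfl | hg
          · simp [split_tmul k Γ B _ hy, projHom_single, single_one_eq_smul,
              Algebra.algebraMap_eq_smul_one, Algebra.TensorProduct.one_def,
              TensorProduct.smul_tmul', smul_smul, mul_comm]
          · simp [split_tmul k Γ B _ hy, projHom_single, counit_eq_zero_of_ne k Γ B hy hg]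
        have h2 := LinearMap.congr_fun h1 (Coalgebra.comul b)
        simp only [LinearMap.comp_apply, Coalgebra.rTensor_counit_comul, LinearEquiv.coe_coe,
          TensorProduct.lid_tmul, one_smul] at h2
        simp only [AlgHom.comp_apply, Bialgebra.comulAlgHom_apply, comul_single,
          ← SkewMonoidAlgebra.one_def, ← Algebra.TensorProduct.one_def, mul_one, projHom_single]
        refine h2.trans ?_
        simp [single_one_eq_smul, Algebra.algebraMap_eq_smul_one]
      · simp [projHom_single, comul_single, BraidedHopfAlgebra.comul_one Γ,
          split_tmul k Γ B _ (isHomogeneous_one k Γ B), BraidedHopfAlgebra.counit_one Γ])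

lemma proj_single (g : Γ) (b : B) :
    proj k Γ B (single g b) = MonoidAlgebra.single g (Coalgebra.counit (R := k) b) :=
  projHom_single k Γ B g b

variable (V : Type*) [AddCommGroup V] [Module k V] [DistribMulAction Γ V]
  [SMulCommClass Γ k V] [LeftComodule k (MonoidAlgebra k Γ) V] [YetterDrinfeld k Γ V]

/-- The map of Hopf algebras `B # kΓ → k(Γ / supp V)`, `b # g ↦ ε(b) [g]`. -/
def projQuotient : Bosonization Γ B →ₐc[k] MonoidAlgebra k (Γ ⧸ supp k Γ V) :=
  (MonoidAlgebra.mapDomainBialgHom k (QuotientGroup.mk' (supp k Γ V))).comp (proj k Γ B)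

end Bosonization

end Bosonization

end ZestingHopf

end

open ZestingHopf

universe u

/-! Write `H` for the bosonization, `ϖ` for `projQuotient`, and `k_g` for the one-dimensional
comodule with coaction `1 ↦ g ⊗ 1`.

The grading of `B` makes `H` a graded coalgebra with degree zero part `kΓ`. A nonzero comodule
therefore contains a nonzero vector whose coaction lies in `kΓ ⊗ M`: slice `ρ(m)` by a functional on
its component of highest degree. A second slice gives a vector with coaction `x ↦ g ⊗ x`, so every
simple comodule is some `k_g` (`exists_span_eq_top`). Since `k_g ⊗ k_h ≅ k_{gh}`, the map `g ↦
g_{k_g}` is a surjective homomorphism from `Γ` to the universal grading group. A nonzero `v` of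
degree `g` is skew-primitive in `H` and gives an indecomposable comodule with subcomodule `k_1` and
quotient `k_g`, so `g` becomes trivial. Thus the homomorphism factors through `Γ / supp V`.

Conversely, `ϖ` is cocentral, so the components of a comodule under the coaction pushed forward
along `ϖ` are again `H`-subcomodules. An indecomposable comodule lies in a single degree
(`exists_hasDegree`), hence the degree of a simple comodule respects all the relations. This gives
the inverse homomorphism.

For a cocentral `π` and `v` of degree `g`, cocentrality at `v` reads `v ⊗ 1 + g ⊗ π(v) = 1 ⊗ π(v) +
v ⊗ π(g)`. For `v ≠ 0`, a functional that is `1` at `v` and `0` on `kΓ` yields `π(g) = 1`. For `g ≠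
1`, the coefficient of `g` in the first leg yields `π(v) = 0`. For `g = 1`, `π(v)` is only known to
be primitive: this suffices when the target is a group algebra, and the hypothesis `V₁ = 0` removes
the case for a general target. Once `π` kills `V` and is trivial on `supp V`, it factors through `ϖ`
(`existsUnique_factor`). -/

noncomputable section

namespace ZestingHopf

universe w

/-! ### The grading of a pre-Nichols algebra and of its bosonization -/

section Grading

open SkewMonoidAlgebra (single lsingle single_mul_single)

/-- The linear map `b # g ↦ f g b` on the bosonization. -/
def Bosonization.linearLift {k Γ B W : Type*} [Field k] [Ring B] [Algebra k B]
    [AddCommGroup W] [Module k W] (f : Γ → B →ₗ[k] W) :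
    Bosonization Γ B →ₗ[k] W :=
  Finsupp.lsum k f ∘ₗ (SkewMonoidAlgebra.coeffLinearEquiv :
    Bosonization Γ B ≃ₗ[k] (Γ →₀ B)).toLinearMap

@[simp] lemma Bosonization.linearLift_single {k Γ B W : Type*} [Field k] [Ring B] [Algebra k B]
    [AddCommGroup W] [Module k W]
    (f : Γ → B →ₗ[k] W) (g : Γ) (b : B) : Bosonization.linearLift f (single g b) = f g b := by
  simp [Bosonization.linearLift, SkewMonoidAlgebra.coeffLinearEquiv,
    SkewMonoidAlgebra.coeffAddEquiv]

variable {k Γ V B : Type*} [Field k] [Group Γ]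
  [AddCommGroup V] [Module k V] [DistribMulAction Γ V]
  [SMulCommClass Γ k V] [LeftComodule k (MonoidAlgebra k Γ) V] [YetterDrinfeld k Γ V]
  [Ring B] [Algebra k B] [Coalgebra k B] [MulSemiringAction Γ B] [SMulCommClass Γ k B]
  [LeftComodule k (MonoidAlgebra k Γ) B] [BraidedHopfAlgebra k Γ B]

namespace PreNicholsAlgebra

variable (hB : PreNicholsAlgebra k Γ V B)

/-- The projection onto the component of degree `n`. -/
def degProj (n : ℕ) : B →ₗ[k] B :=
  (hB.deg n).subtype ∘ₗ DirectSum.component k ℕ (fun i ↦ hB.deg i) n ∘ₗ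
    (LinearEquiv.ofBijective (DirectSum.coeLinearMap hB.deg) hB.isInternal).symm.toLinearMap

lemma symm_apply_of_mem {m : ℕ} {b : B} (hb : b ∈ hB.deg m) :
    (LinearEquiv.ofBijective (DirectSum.coeLinearMap hB.deg) hB.isInternal).symm b =
      DirectSum.lof k ℕ (fun i ↦ hB.deg i) m ⟨b, hb⟩ := by
  rw [LinearEquiv.symm_apply_eq]
  exact (DirectSum.coeLinearMap_lof hB.deg m ⟨b, hb⟩).symm

lemma degProj_of_mem {n : ℕ} {b : B} (hb : b ∈ hB.deg n) : hB.degProj n b = b := by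
  simp [degProj, hB.symm_apply_of_mem hb, DirectSum.component.lof_self]

lemma degProj_of_mem_of_ne {m n : ℕ} {b : B} (hb : b ∈ hB.deg m) (h : m ≠ n) :
    hB.degProj n b = 0 := by
  simp [degProj, hB.symm_apply_of_mem hb, DirectSum.component.of, h]

lemma deg_induction {p : B → Prop} (zero : p 0) (add : ∀ x y, p x → p y → p (x + y))
    (mem : ∀ n, ∀ x ∈ hB.deg n, p x) (x : B) : p x := by
  have hx : x ∈ ⨆ n, hB.deg n := by
    rw [hB.isInternal.submodule_iSup_eq_top]; trivial
  exact Submodule.iSup_induction _ (motive := p) hx mem zero add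

lemma linearMap_ext_deg {W : Type*} [AddCommGroup W] [Module k W] {f f' : B →ₗ[k] W}
    (h : ∀ n, ∀ x ∈ hB.deg n, f x = f' x) : f = f' :=
  LinearMap.ext fun x ↦ hB.deg_induction (p := fun x ↦ f x = f' x) (by simp)
    (fun x y hx hy ↦ by simp [hx, hy]) h x

/-- `B⁰` is spanned by `1`, where the counit is `1`, and the counit vanishes in all other degrees.
-/
lemma degProj_zero (b : B) : hB.degProj 0 b = Coalgebra.counit (R := k) b • (1 : B) := by
  have : hB.degProj 0 = (Coalgebra.counit : B →ₗ[k] k).smulRight 1 := by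
    refine hB.linearMap_ext_deg fun n x hx ↦ ?_
    rcases eq_or_ne n 0 with rfl | hn
    · rw [hB.degProj_of_mem hx]
      rw [hB.deg_zero] at hx
      obtain ⟨r, rfl⟩ := Submodule.mem_span_singleton.1 hx
      simp [BraidedHopfAlgebra.counit_one Γ]
    · simp [hB.degProj_of_mem_of_ne hx hn, hB.counit_eq_zero n x hn hx]
  simp [this]

lemma isComoduleHom_degProj (n : ℕ) : IsComoduleHom k (MonoidAlgebra k Γ) (hB.degProj n) := by
  refine hB.linearMap_ext_deg fun m x hx ↦ ?_
  obtain ⟨t, ht⟩ := hB.isSubcomodule m x hx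
  rw [LinearMap.comp_apply, LinearMap.comp_apply, ← ht, ← LinearMap.comp_apply (LinearMap.lTensor _ _),
    ← LinearMap.lTensor_comp]
  rcases eq_or_ne m n with rfl | h
  · have : hB.degProj m ∘ₗ (hB.deg m).subtype = (hB.deg m).subtype :=
      LinearMap.ext fun y ↦ hB.degProj_of_mem y.2
    rw [this, ht, hB.degProj_of_mem hx]
  · have : hB.degProj n ∘ₗ (hB.deg m).subtype = 0 :=
      LinearMap.ext fun y ↦ hB.degProj_of_mem_of_ne y.2 h
    rw [this, hB.degProj_of_mem_of_ne hx h]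
    simp

/-- `Δ(b)` lies in the sum of the `B^p ⊗ B^q` with `p + q = n`, and on each of these one of the two
projections is zero. -/
lemma map_degProj_comul_of_mem {i j n : ℕ} {b : B} (hb : b ∈ hB.deg n) (h : i + j ≠ n) :
    TensorProduct.map (hB.degProj i) (hB.degProj j) (Coalgebra.comul (R := k) b) = 0 := by
  have key : (⨆ p ∈ Finset.HasAntidiagonal.antidiagonal n,
      LinearMap.range (TensorProduct.map (hB.deg p.1).subtype (hB.deg p.2).subtype)) ≤
      LinearMap.ker (TensorProduct.map (hB.degProj i) (hB.degProj j)) := by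
    refine iSup₂_le fun p hp ↦ ?_
    rw [LinearMap.range_le_ker_iff, ← TensorProduct.map_comp]
    replace hp := Finset.HasAntidiagonal.mem_antidiagonal.1 hp
    by_cases h1 : p.1 = i
    · have : hB.degProj j ∘ₗ (hB.deg p.2).subtype = 0 :=
        LinearMap.ext fun y ↦ hB.degProj_of_mem_of_ne y.2 (by omega)
      rw [this, TensorProduct.map_zero_right]
    · have : hB.degProj i ∘ₗ (hB.deg p.1).subtype = 0 :=
        LinearMap.ext fun y ↦ hB.degProj_of_mem_of_ne y.2 h1
      rw [this, TensorProduct.map_zero_left]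
  exact key (hB.comul_mem n b hb)

/-- Elements of degree one are primitive. -/
lemma comul_of_mem_deg_one {b : B} (hb : b ∈ hB.deg 1) :
    Coalgebra.comul (R := k) b = b ⊗ₜ[k] 1 + 1 ⊗ₜ[k] b := by
  -- As `B⁰ = k`, the two summands of `Δ(b)` have the form `1 ⊗ c` and `d ⊗ 1`; the two counit
  -- axioms then force `c = b` and `d = b`.
  have h1 : ∀ t : hB.deg 0 ⊗[k] hB.deg 1, ∃ c ∈ hB.deg 1,
      TensorProduct.map (hB.deg 0).subtype (hB.deg 1).subtype t = 1 ⊗ₜ[k] c := by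
    intro t
    induction t with
    | zero => exact ⟨0, zero_mem _, by simp⟩
    | add x y hx hy =>
      obtain ⟨c, hc, hx⟩ := hx
      obtain ⟨d, hd, hy⟩ := hy
      exact ⟨c + d, add_mem hc hd, by rw [map_add, hx, hy, TensorProduct.tmul_add]⟩
    | tmul x y =>
      obtain ⟨r, hr⟩ := Submodule.mem_span_singleton.1 (hB.deg_zero.le x.2)
      exact ⟨r • y.1, Submodule.smul_mem _ _ y.2, by simp [← hr, TensorProduct.smul_tmul]⟩
  have h2 : ∀ t : hB.deg 1 ⊗[k] hB.deg 0, ∃ c ∈ hB.deg 1,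
      TensorProduct.map (hB.deg 1).subtype (hB.deg 0).subtype t = c ⊗ₜ[k] 1 := by
    intro t
    induction t with
    | zero => exact ⟨0, zero_mem _, by simp⟩
    | add x y hx hy =>
      obtain ⟨c, hc, hx⟩ := hx
      obtain ⟨d, hd, hy⟩ := hy
      exact ⟨c + d, add_mem hc hd, by rw [map_add, hx, hy, TensorProduct.add_tmul]⟩
    | tmul x y =>
      obtain ⟨r, hr⟩ := Submodule.mem_span_singleton.1 (hB.deg_zero.le y.2)
      exact ⟨r • x.1, Submodule.smul_mem _ _ x.2, by simp [← hr, TensorProduct.smul_tmul]⟩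
  have h3 := hB.comul_mem 1 b hb
  have h4 : Finset.HasAntidiagonal.antidiagonal 1 = {((0 : ℕ), (1 : ℕ)), (1, 0)} := rfl
  rw [h4, Finset.iSup_insert, Finset.iSup_singleton] at h3
  obtain ⟨_, ⟨s, rfl⟩, _, ⟨t, rfl⟩, hst⟩ := Submodule.mem_sup.1 h3
  obtain ⟨c, hc, hs⟩ := h1 s
  obtain ⟨d, hd, ht⟩ := h2 t
  rw [hs, ht] at hst
  have h5 := Coalgebra.rTensor_counit_comul (R := k) b
  have h6 := Coalgebra.lTensor_counit_comul (R := k) b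
  rw [← hst] at h5 h6 ⊢
  have h7 := congrArg (TensorProduct.lid k B) h5
  have h8 := congrArg (TensorProduct.rid k B) h6
  simp [BraidedHopfAlgebra.counit_one Γ, hB.counit_eq_zero 1 _ one_ne_zero hc,
    hB.counit_eq_zero 1 _ one_ne_zero hd] at h7 h8
  rw [h7, h8, add_comm]

/-! ### The induced grading of the bosonization -/

/-- The projection of the bosonization onto `Bⁿ # kΓ`. -/
def gradeProj (n : ℕ) : Bosonization Γ B →ₗ[k] Bosonization Γ B :=
  Bosonization.linearLift fun g ↦ lsingle k g ∘ₗ hB.degProj n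

@[simp] lemma gradeProj_single (n : ℕ) (g : Γ) (b : B) :
    hB.gradeProj n (single g b) = single g (hB.degProj n b) := by
  simp [gradeProj, Bosonization.lsingle_eq]

/-- The degree zero part of the bosonization is the group algebra. This is how vanishing in positive
degrees puts a coaction into `kΓ ⊗ M`. -/
lemma gradeProj_zero (x : Bosonization Γ B) :
    hB.gradeProj 0 x = Bosonization.ofGroup k Γ B (Bosonization.proj k Γ B x) := by
  have : hB.gradeProj 0 = (Bosonization.ofGroup k Γ B).toLinearMap ∘ₗ
      (Bosonization.projHom k Γ B).toLinearMap := by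
    refine SkewMonoidAlgebra.lhom_ext fun g b ↦ ?_
    simp [Bosonization.projHom_single, hB.degProj_zero, SkewMonoidAlgebra.smul_single]
  exact LinearMap.congr_fun this x

/-- `split` moves the `Γ`-degree of the second factor into the first leg, and `degProj` preserves
`Γ`-degrees. -/
lemma map_gradeProj_split (i j : ℕ) (t : B ⊗[k] B) :
    TensorProduct.map (hB.gradeProj i) (hB.gradeProj j) (Bosonization.split k Γ B t) =
      Bosonization.split k Γ B (TensorProduct.map (hB.degProj i) (hB.degProj j) t) := by
  have : TensorProduct.map (hB.gradeProj i) (hB.gradeProj j) ∘ₗ Bosonization.split k Γ B =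
      Bosonization.split k Γ B ∘ₗ TensorProduct.map (hB.degProj i) (hB.degProj j) := by
    refine tensor_ext_homogeneous k (Γ := Γ) fun g h a b ha hb ↦ ?_
    have hb' := hb.map (hB.isComoduleHom_degProj j)
    simp [Bosonization.split_tmul k Γ B _ hb, Bosonization.split_tmul k Γ B _ hb']
  exact LinearMap.congr_fun this t

lemma map_gradeProj_mul (i j : ℕ) (g : Γ) (t : Bosonization Γ B ⊗[k] Bosonization Γ B) :
    TensorProduct.map (hB.gradeProj i) (hB.gradeProj j)
        (t * (single g (1 : B) ⊗ₜ[k] single g (1 : B))) =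
      TensorProduct.map (hB.gradeProj i) (hB.gradeProj j) t *
        (single g (1 : B) ⊗ₜ[k] single g (1 : B)) := by
  have h : ∀ n, hB.gradeProj n ∘ₗ LinearMap.mulRight k (single g (1 : B)) =
      LinearMap.mulRight k (single g (1 : B)) ∘ₗ hB.gradeProj n := fun n ↦
    SkewMonoidAlgebra.lhom_ext fun h b ↦ by simp
  induction t with
  | zero => simp
  | add x y hx hy => simp only [add_mul, map_add, hx, hy]
  | tmul x y =>
    have hx := LinearMap.congr_fun (h i) x
    have hy := LinearMap.congr_fun (h j) y
    simp only [LinearMap.comp_apply, LinearMap.mulRight_apply] at hx hy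
    simp [hx, hy]

/-- The comultiplication of the bosonization is graded. -/
lemma map_gradeProj_comul (i j : ℕ) (x : Bosonization Γ B) :
    TensorProduct.map (hB.gradeProj i) (hB.gradeProj j) (Coalgebra.comul (R := k) x) =
      TensorProduct.map (hB.gradeProj i) (hB.gradeProj j)
        (Coalgebra.comul (R := k) (hB.gradeProj (i + j) x)) := by
  have : TensorProduct.map (hB.gradeProj i) (hB.gradeProj j) ∘ₗ Coalgebra.comul =
      TensorProduct.map (hB.gradeProj i) (hB.gradeProj j) ∘ₗ Coalgebra.comul ∘ₗ
        hB.gradeProj (i + j) := by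
    refine SkewMonoidAlgebra.lhom_ext' fun g ↦ hB.linearMap_ext_deg fun n b hb ↦ ?_
    simp only [LinearMap.comp_apply, Bosonization.lsingle_eq, gradeProj_single]
    rcases eq_or_ne n (i + j) with rfl | h
    · rw [hB.degProj_of_mem hb]
    · rw [hB.degProj_of_mem_of_ne hb h, Bosonization.comul_single, map_gradeProj_mul,
        map_gradeProj_split, hB.map_degProj_comul_of_mem hb h.symm]
      simp
  exact LinearMap.congr_fun this x

/-- Every element of `H ⊗ M` is the sum of its finitely many nonzero components. -/
lemma exists_eq_sum_gradeProj (M : Type*) [AddCommGroup M] [Module k M]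
    (t : Bosonization Γ B ⊗[k] M) : ∃ N : ℕ, ∀ N' ≥ N,
      t = ∑ n ∈ Finset.range N', (hB.gradeProj n).rTensor M t := by
  -- Requiring the identity for every `N' ≥ N` allows two elements to share the larger bound.
  have hadd : ∀ x y : Bosonization Γ B ⊗[k] M,
      (∃ N : ℕ, ∀ N' ≥ N, x = ∑ n ∈ Finset.range N', (hB.gradeProj n).rTensor M x) →
      (∃ N : ℕ, ∀ N' ≥ N, y = ∑ n ∈ Finset.range N', (hB.gradeProj n).rTensor M y) →
      ∃ N : ℕ, ∀ N' ≥ N, x + y = ∑ n ∈ Finset.range N', (hB.gradeProj n).rTensor M (x + y) := by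
    rintro x y ⟨N, hN⟩ ⟨N₁, hN₁⟩
    refine ⟨max N N₁, fun N' h ↦ ?_⟩
    simp only [map_add, Finset.sum_add_distrib]
    rw [← hN N' (le_trans (le_max_left _ _) h), ← hN₁ N' (le_trans (le_max_right _ _) h)]
  induction t with
  | zero => exact ⟨0, by simp⟩
  | add x y hx hy => exact hadd x y hx hy
  | tmul x m =>
    induction x using SkewMonoidAlgebra.induction_on with
    | zero => exact ⟨0, by simp⟩
    | add x y hx hy =>
      rw [TensorProduct.add_tmul]
      exact hadd _ _ hx hy
    | single g b =>
      induction b using hB.deg_induction with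
      | zero => exact ⟨0, by simp⟩
      | add x y hx hy =>
        rw [SkewMonoidAlgebra.single_add, TensorProduct.add_tmul]
        exact hadd _ _ hx hy
      | mem n x hx =>
        refine ⟨n + 1, fun N' h ↦ ?_⟩
        rw [Finset.sum_eq_single n]
        · simp [hB.degProj_of_mem hx]
        · intro m _ hm
          simp [hB.degProj_of_mem_of_ne hx hm.symm]
        · intro hn
          exact absurd (Finset.mem_range.2 (by omega)) hn

/-! ### The generators of the bosonization: skew-primitive elements and group elements -/

lemma incl_mem (v : V) : hB.incl v ∈ hB.deg 1 := by
  rw [← hB.range_incl]; exact ⟨v, rfl⟩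

/-- The comultiplication of `v # 1`, where `v` is homogeneous of degree `g`. -/
lemma comul_incl {g : Γ} {v : V} (hv : IsHomogeneous k Γ g v) :
    Coalgebra.comul (R := k) (single 1 (hB.incl v) : Bosonization Γ B) =
      single 1 (hB.incl v) ⊗ₜ[k] 1 + single g 1 ⊗ₜ[k] single 1 (hB.incl v) := by
  rw [Bosonization.comul_single, hB.comul_of_mem_deg_one (hB.incl_mem v), map_add,
    Bosonization.split_tmul k Γ B _ (Bosonization.isHomogeneous_one k Γ B),
    Bosonization.split_tmul k Γ B _ (hv.map hB.isComoduleHom_incl)]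
  simp [add_mul]

lemma comul_single_one (g : Γ) :
    Coalgebra.comul (R := k) (single g 1 : Bosonization Γ B) =
      single g 1 ⊗ₜ[k] single g 1 := by
  simp [Bosonization.comul_single, BraidedHopfAlgebra.comul_one Γ,
    Bosonization.split_tmul k Γ B _ (Bosonization.isHomogeneous_one k Γ B)]

lemma proj_incl (v : V) : Bosonization.proj k Γ B (single 1 (hB.incl v)) = 0 := by
  simp [Bosonization.proj_single, hB.counit_eq_zero 1 _ one_ne_zero (hB.incl_mem v)]

/-- The bosonization is generated by the homogeneous elements of `V` and by `Γ`. -/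
lemma bosonization_algHom_ext {A : Type*} [Semiring A] [Algebra k A]
    {f f' : Bosonization Γ B →ₐ[k] A}
    (h : ∀ (g : Γ) (v : V), IsHomogeneous k Γ g v →
      f (single 1 (hB.incl v)) = f' (single 1 (hB.incl v)))
    (h' : ∀ g, f (single g 1) = f' (single g 1)) : f = f' := by
  refine Bosonization.algHom_ext k Γ B (fun b ↦ ?_) h'
  have hV : ∀ v, f (single 1 (hB.incl v)) = f' (single 1 (hB.incl v)) := by
    intro v
    refine homogeneous_induction k (Γ := Γ) (p := fun v ↦ f (single 1 (hB.incl v)) =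
      f' (single 1 (hB.incl v))) (by simp) (fun x y hx hy ↦ ?_) h v
    rw [map_add, SkewMonoidAlgebra.single_add, map_add, map_add, hx, hy]
  have hb : b ∈ Algebra.adjoin k (Set.range hB.incl) := by
    rw [hB.adjoin_eq_top]; trivial
  induction hb using Algebra.adjoin_induction with
  | mem x hx => obtain ⟨v, rfl⟩ := hx; exact hV v
  | algebraMap r =>
    have : (single 1 (algebraMap k B r) : Bosonization Γ B) = algebraMap k _ r := rfl
    rw [this, AlgHom.commutes, AlgHom.commutes]
  | add x y _ _ hx hy => rw [SkewMonoidAlgebra.single_add, map_add, map_add, hx, hy]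
  | mul x y _ _ hx hy =>
    have : (single 1 (x * y) : Bosonization Γ B) = single 1 x * single 1 y := by simp
    rw [this, map_mul, map_mul, hx, hy]

/-- A functional on the bosonization that does not vanish at `v # 1` and vanishes on `kΓ`. -/
lemma exists_functional {v : V} (hv : v ≠ 0) : ∃ f : Bosonization Γ B →ₗ[k] k,
    f (single 1 (hB.incl v)) = 1 ∧ ∀ g, f (single g 1) = 0 := by
  have h0 : hB.incl v ≠ 0 := fun h ↦ hv (hB.incl_injective (by simpa using h))
  obtain ⟨μ, hμ⟩ := Module.Projective.exists_dual_eq_one k h0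
  -- Composing with the projection to degree one makes the functional vanish on `kΓ`, which sits in
  -- degree zero; the group component is ignored.
  refine ⟨Bosonization.linearLift fun _ ↦ μ ∘ₗ hB.degProj 1, ?_, fun g ↦ ?_⟩
  · simp [hB.degProj_of_mem (hB.incl_mem v), hμ]
  · have : (1 : B) ∈ hB.deg 0 := by rw [hB.deg_zero]; exact Submodule.mem_span_singleton_self 1
    simp [hB.degProj_of_mem_of_ne this zero_ne_one]

end PreNicholsAlgebra

end Grading

/-! ### Cocentral maps out of the bosonization -/

section Cocentral

open SkewMonoidAlgebra (single)

/-- Primitive elements of a group algebra vanish. -/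
lemma eq_zero_of_isPrimitive {k G : Type*} [Field k] [Group G] {x : MonoidAlgebra k G}
    (hx : Coalgebra.comul (R := k) x = x ⊗ₜ[k] 1 + 1 ⊗ₜ[k] x) : x = 0 := by
  classical
  let δ : G → MonoidAlgebra k G →ₗ[k] k := fun g ↦ Finsupp.lapply g ∘ₗ
    (MonoidAlgebra.coeffLinearEquiv k : MonoidAlgebra k G ≃ₗ[k] (G →₀ k)).toLinearMap
  have hδ : ∀ g h r, δ g (MonoidAlgebra.single h r) = if h = g then r else 0 := fun g h r ↦ by
    simp [δ, MonoidAlgebra.coeffLinearEquiv, MonoidAlgebra.coeff_single, Finsupp.single_apply]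
  -- The comultiplication is diagonal on group elements, so `(δ_g ⊗ δ_g) Δ = δ_g`. At a primitive
  -- `x` this gives `δ_g(x) = 2 δ_g(x) δ_g(1)`, which forces `δ_g(x) = 0` both for `g = 1` and for
  -- `g ≠ 1`, in any characteristic.
  have h1 : ∀ g, LinearMap.mul' k k ∘ₗ TensorProduct.map (δ g) (δ g) ∘ₗ Coalgebra.comul = δ g := by
    intro g
    refine LinearMap.ext fun y ↦ ?_
    induction y using MonoidAlgebra.induction_linear with
    | zero => simp
    | add a b ha hb => rw [map_add, map_add, ha, hb]
    | single h r =>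
      simp only [LinearMap.comp_apply, MonoidAlgebra.comul_single, CommSemiring.comul_apply,
        TensorProduct.map_tmul, MonoidAlgebra.lsingle_apply, hδ, LinearMap.mul'_apply]
      split_ifs <;> simp
  have h2 : ∀ g, δ g x = 0 := by
    intro g
    have h := LinearMap.congr_fun (h1 g) x
    simp only [LinearMap.comp_apply, hx, map_add, TensorProduct.map_tmul, LinearMap.mul'_apply,
      MonoidAlgebra.one_def, hδ] at h
    split_ifs at h
    · simpa using h
    · simpa using h.symm
  exact MonoidAlgebra.ext (Finsupp.ext h2)

variable {k Γ V B : Type*} [Field k] [Group Γ]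
  [AddCommGroup V] [Module k V] [DistribMulAction Γ V]
  [SMulCommClass Γ k V] [LeftComodule k (MonoidAlgebra k Γ) V] [YetterDrinfeld k Γ V]
  [Ring B] [Algebra k B] [Coalgebra k B] [MulSemiringAction Γ B] [SMulCommClass Γ k B]
  [LeftComodule k (MonoidAlgebra k Γ) B] [BraidedHopfAlgebra k Γ B]

/-! ### The map `ϖ` and its cocentrality -/

lemma projQuotient_single (g : Γ) (b : B) :
    Bosonization.projQuotient k Γ B V (single g b) =
      MonoidAlgebra.single (QuotientGroup.mk g) (Coalgebra.counit (R := k) b) := by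
  simp [Bosonization.projQuotient, Bosonization.proj_single]

lemma projQuotient_single_one (g : Γ) :
    Bosonization.projQuotient k Γ B V (single g 1) =
      MonoidAlgebra.single (QuotientGroup.mk g) 1 := by
  rw [projQuotient_single, BraidedHopfAlgebra.counit_one Γ]

lemma projQuotient_surjective : Function.Surjective (Bosonization.projQuotient k Γ B V) := by
  intro x
  induction x using MonoidAlgebra.induction_linear with
  | zero => exact ⟨0, map_zero _⟩
  | add x y hx hy =>
    obtain ⟨a, rfl⟩ := hx
    obtain ⟨b, rfl⟩ := hy
    exact ⟨a + b, map_add _ _ _⟩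
  | single g r =>
    obtain ⟨g, rfl⟩ := QuotientGroup.mk_surjective g
    exact ⟨r • single g 1, by simp [projQuotient_single_one]⟩

namespace PreNicholsAlgebra

lemma projQuotient_incl (hB : PreNicholsAlgebra k Γ V B) (v : V) :
    Bosonization.projQuotient k Γ B V (single 1 (hB.incl v)) = 0 := by
  simp [projQuotient_single, hB.counit_eq_zero 1 _ one_ne_zero (hB.incl_mem v)]

/-- Both sides of the cocentrality condition are algebra maps, so generators suffice. At `v` of
degree `g` the condition becomes `v ⊗ 1 = v ⊗ [g]`, which holds because `g` lies in the support as
soon as `v ≠ 0`. -/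
lemma isCocentral_projQuotient (hB : PreNicholsAlgebra k Γ V B) :
    IsCocentral (Bosonization.projQuotient k Γ B V) := by
  let F := Algebra.TensorProduct.map (AlgHom.id k (Bosonization Γ B))
    (Bosonization.projQuotient k Γ B V : Bosonization Γ B →ₐ[k] MonoidAlgebra k (Γ ⧸ supp k Γ V))
  have h : F.comp (Bialgebra.comulAlgHom k (Bosonization Γ B)) =
      F.comp ((Algebra.TensorProduct.comm k (Bosonization Γ B) (Bosonization Γ B)).toAlgHom.comp
        (Bialgebra.comulAlgHom k (Bosonization Γ B))) := by
    refine hB.bosonization_algHom_ext (fun g v hv ↦ ?_) fun g ↦ ?_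
    · rcases eq_or_ne v 0 with rfl | h0
      · simp
      · have hg : (QuotientGroup.mk g : Γ ⧸ supp k Γ V) = 1 :=
          (QuotientGroup.eq_one_iff g).2 (Subgroup.subset_closure ⟨v, h0, hv⟩)
        simp [F, hB.comul_incl hv, hB.projQuotient_incl, projQuotient_single_one, hg,
          MonoidAlgebra.one_def]
    · simp [F, PreNicholsAlgebra.comul_single_one]
  exact congrArg AlgHom.toLinearMap h

/-! ### Factoring cocentral maps through `ϖ` -/

section Factor

variable {K : Type*} [Ring K] [Bialgebra k K] {π : Bosonization Γ B →ₐc[k] K}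

/-- Cocentrality evaluated at the skew-primitive element `v # 1`; every constraint on `π` used below
is read off from this identity. -/
lemma cocentral_incl (hB : PreNicholsAlgebra k Γ V B) (hπ : IsCocentral π)
    {g : Γ} {v : V} (hv : IsHomogeneous k Γ g v) :
    single 1 (hB.incl v) ⊗ₜ[k] 1 + single g 1 ⊗ₜ[k] π (single 1 (hB.incl v)) =
      1 ⊗ₜ[k] π (single 1 (hB.incl v)) + single 1 (hB.incl v) ⊗ₜ[k] π (single g 1) := by
  have h := LinearMap.congr_fun hπ (single 1 (hB.incl v))
  simpa [hB.comul_incl hv] using h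

/-- A functional that is `1` at `v` and `0` on `kΓ`, applied to the first leg of `cocentral_incl`,
leaves only `1 = π(g)`. -/
lemma cocentral_single_eq_one (hB : PreNicholsAlgebra k Γ V B) (hπ : IsCocentral π)
    {g : Γ} {v : V} (hv : IsHomogeneous k Γ g v) (h0 : v ≠ 0) :
    π (single g 1) = 1 := by
  obtain ⟨f, hf, hf'⟩ := hB.exists_functional h0
  have h := congrArg (TensorProduct.lid k K) (congrArg (f.rTensor K) (hB.cocentral_incl hπ hv))
  have h1 : f 1 = 0 := hf' 1
  simpa [hf, hf', h1] using h.symm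

/-- Projecting the first leg to `kΓ` kills both terms with `v` there and leaves `g ⊗ π(v) = 1 ⊗
π(v)`; then compare coefficients of `g`. -/
lemma cocentral_incl_eq_zero (hB : PreNicholsAlgebra k Γ V B) (hπ : IsCocentral π)
    {g : Γ} {v : V} (hv : IsHomogeneous k Γ g v) (hg : g ≠ 1) :
    π (single 1 (hB.incl v)) = 0 := by
  have h := congrArg (coeffAt k K g) (congrArg
    ((Bosonization.proj k Γ B : Bosonization Γ B →ₗ[k] MonoidAlgebra k Γ).rTensor K)
    (hB.cocentral_incl hπ hv))
  simpa [hB.proj_incl, Bosonization.proj_single, BraidedHopfAlgebra.counit_one Γ,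
    MonoidAlgebra.coeff_single, MonoidAlgebra.one_def, hg, Finsupp.single_apply, hg.symm] using h

/-- The common core of both universal properties: the two hypotheses say that `π` is trivial on the
generators of `supp V` and kills `V`, so `π` is determined by its restriction to `Γ`, which descends
to the quotient. -/
lemma existsUnique_factor (hB : PreNicholsAlgebra k Γ V B)
    (h1 : ∀ (g : Γ) (v : V), v ≠ 0 → IsHomogeneous k Γ g v → π (single g 1) = 1)
    (h2 : ∀ (g : Γ) (v : V), IsHomogeneous k Γ g v → π (single 1 (hB.incl v)) = 0) :
    ∃! f : MonoidAlgebra k (Γ ⧸ supp k Γ V) →ₐc[k] K,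
      f.comp (Bosonization.projQuotient k Γ B V) = π := by
  let φ : Γ →* K :=
    { toFun := fun g ↦ π (single g 1)
      map_one' := map_one π
      map_mul' := fun g h ↦ by rw [← map_mul]; simp }
  have hφ : supp k Γ V ≤ φ.ker := by
    refine (Subgroup.closure_le _).2 ?_
    rintro g ⟨v, h0, hv⟩
    exact h1 g v h0 hv
  -- `π` sends group-like elements to group-like elements; this makes the lifted algebra map a map
  -- of bialgebras.
  have hcomul : ∀ g, Coalgebra.comul (R := k) (φ g) = φ g ⊗ₜ[k] φ g := fun g ↦ by
    have h := CoalgHomClass.map_comp_comul_apply π (single g 1)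
    rw [PreNicholsAlgebra.comul_single_one] at h
    exact h.symm
  have hcounit : ∀ g, Coalgebra.counit (R := k) (φ g) = 1 := fun g ↦ by
    have h := CoalgHomClass.counit_comp_apply π (single g 1)
    rwa [Bosonization.counit_single, BraidedHopfAlgebra.counit_one Γ] at h
  let f : MonoidAlgebra k (Γ ⧸ supp k Γ V) →ₐc[k] K := BialgHom.ofAlgHom
    (MonoidAlgebra.lift k K _ (QuotientGroup.lift (supp k Γ V) φ hφ))
    (by
      refine MonoidAlgebra.algHom_ext' (MonoidHom.ext fun g ↦ ?_) (by ext)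
      obtain ⟨g, rfl⟩ := QuotientGroup.mk_surjective g
      simp [hcounit])
    (by
      refine MonoidAlgebra.algHom_ext' (MonoidHom.ext fun g ↦ ?_) (by ext)
      obtain ⟨g, rfl⟩ := QuotientGroup.mk_surjective g
      simp [hcomul])
  have hf : ∀ g : Γ, f (MonoidAlgebra.single (QuotientGroup.mk g) 1) = π (single g 1) := by
    intro g
    simp [f, φ]
  refine ⟨f, ?_, fun f' hf' ↦ ?_⟩
  · have h : ((f.comp (Bosonization.projQuotient k Γ B V) : Bosonization Γ B →ₐc[k] K) :
        Bosonization Γ B →ₐ[k] K) = (π : Bosonization Γ B →ₐ[k] K) := by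
      refine hB.bosonization_algHom_ext (fun g v hv ↦ ?_) fun g ↦ ?_
      · simp [hB.projQuotient_incl, h2 g v hv]
      · simp [projQuotient_single_one, hf]
    exact DFunLike.ext _ _ fun x ↦ DFunLike.congr_fun h x
  · refine MonoidAlgebra.bialgHom_ext (fun g ↦ ?_) (by ext)
    obtain ⟨g, rfl⟩ := QuotientGroup.mk_surjective g
    rw [hf, ← hf', ← projQuotient_single_one (B := B)]
    rfl

end Factor

/-- The universal property of `ϖ` among cocentral maps to group algebras. -/
lemma existsUnique_monoidHom (hB : PreNicholsAlgebra k Γ V B) {G : Type*} [Group G]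
    {π : Bosonization Γ B →ₐc[k] MonoidAlgebra k G}
    (hπ : IsCocentral π) : ∃! f : Γ ⧸ supp k Γ V →* G,
      (MonoidAlgebra.mapDomainBialgHom k f).comp (Bosonization.projQuotient k Γ B V) = π := by
  have h := hB.existsUnique_factor (fun g v h0 hv ↦ hB.cocentral_single_eq_one hπ hv h0)
    (fun g v hv ↦ by
      rcases eq_or_ne g 1 with rfl | hg
      -- For `g = 1` the identity `cocentral_incl` says nothing about `π(v)`, but `v # 1` is
      -- primitive, hence so is its image.
      · refine eq_zero_of_isPrimitive ?_
        have h := CoalgHomClass.map_comp_comul_apply π (single 1 (hB.incl v))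
        rw [hB.comul_incl hv] at h
        simpa using h.symm
      · exact hB.cocentral_incl_eq_zero hπ hv hg)
  -- Bialgebra maps between group algebras over a field correspond bijectively to group
  -- homomorphisms.
  exact (MonoidAlgebra.mapDomainBialgHomEquiv (R := k).bijective.existsUnique_iff
    (p := fun f ↦ f.comp (Bosonization.projQuotient k Γ B V) = π)).1 h

end PreNicholsAlgebra

/-- If `V₁ = 0`, then `ϖ` is the Hopf cocenter of the bosonization. -/
lemma PreNicholsAlgebra.isHopfCocenter_projQuotient {k Γ V B : Type u} [Field k] [Group Γ]
    [AddCommGroup V] [Module k V] [DistribMulAction Γ V]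
    [SMulCommClass Γ k V] [LeftComodule k (MonoidAlgebra k Γ) V] [YetterDrinfeld k Γ V]
    [Ring B] [Algebra k B] [Coalgebra k B] [MulSemiringAction Γ B] [SMulCommClass Γ k B]
    [LeftComodule k (MonoidAlgebra k Γ) B] [BraidedHopfAlgebra k Γ B]
    (hB : PreNicholsAlgebra k Γ V B) (hV : ∀ x : V, IsHomogeneous k Γ 1 x → x = 0) :
    IsHopfCocenter (Bosonization.projQuotient k Γ B V) := by
  refine ⟨hB.isCocentral_projQuotient, projQuotient_surjective, fun K _ _ π hπ ↦ ?_⟩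
  refine hB.existsUnique_factor (fun g v h0 hv ↦ hB.cocentral_single_eq_one hπ hv h0)
    fun g v hv ↦ ?_
  -- The assumption on `V₁` is needed only for `g = 1`, since `K` may have nonzero primitive
  -- elements.
  rcases eq_or_ne g 1 with rfl | hg
  · simp [hV v hv]
  · exact hB.cocentral_incl_eq_zero hπ hv hg

end Cocentral

/-! ### Comodules graded by a cocentral map -/

section GradedComodule

lemma exists_slice_ne_zero {ι k C M : Type*} [Field k] [AddCommGroup C] [Module k C]
    [AddCommGroup M] [Module k M] (b : Module.Basis ι k C) {t : C ⊗[k] M} (ht : t ≠ 0) :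
    ∃ i, TensorProduct.lid k M ((b.coord i).rTensor M t) ≠ 0 := by
  classical
  by_contra! h
  refine ht ((TensorProduct.equivFinsuppOfBasisLeft b).injective ?_)
  rw [map_zero]
  exact Finsupp.ext fun i ↦ by
    rw [TensorProduct.equivFinsuppOfBasisLeft_apply]; exact h i

/-! ### Slices of coactions and idempotent comodule endomorphisms -/

section Coalgebra

variable {k C D M : Type*} [Field k] [AddCommGroup C] [Module k C] [Coalgebra k C]
  [AddCommGroup D] [Module k D] [Coalgebra k D]
  [AddCommGroup M] [Module k M] [LeftComodule k C M]

lemma coassoc_apply (x : M) :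
    TensorProduct.assoc k C C M (Coalgebra.comul.rTensor M (coact k C x)) =
      (coact k C).lTensor C (coact k C x) :=
  LinearMap.congr_fun LeftComodule.coassoc x

lemma counit_coact_apply (x : M) :
    TensorProduct.lid k M (Coalgebra.counit.rTensor M (coact k C x)) = x :=
  LinearMap.congr_fun LeftComodule.counit_coact x

lemma coact_ne_zero {x : M} (hx : x ≠ 0) : coact k C x ≠ 0 := fun h ↦ hx <| by
  rw [← counit_coact_apply (k := k) (C := C) x, h, map_zero, map_zero]

lemma isComoduleHom_id : IsComoduleHom k C (LinearMap.id : M →ₗ[k] M) :=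
  LinearMap.ext fun x ↦ by
    rw [LinearMap.comp_apply, LinearMap.comp_apply, LinearMap.lTensor_id, LinearMap.id_apply,
      LinearMap.id_apply]

/-- The coaction on `c(x₍₋₁₎) x₍₀₎`. -/
lemma coact_slice (c : C →ₗ[k] k) (x : M) :
    coact k C (TensorProduct.lid k M (c.rTensor M (coact k C x))) =
      TensorProduct.lid k _ (c.rTensor _
        (TensorProduct.assoc k C C M (Coalgebra.comul.rTensor M (coact k C x)))) := by
  have h : ∀ t : C ⊗[k] M, coact k C (TensorProduct.lid k M (c.rTensor M t)) =
      TensorProduct.lid k _ (c.rTensor _ ((coact k C).lTensor C t)) := by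
    intro t
    induction t with
    | zero => simp
    | add a b ha hb => simp only [map_add, ha, hb]
    | tmul a y => simp
  rw [h, coassoc_apply]

/-- `c(x₍₋₁₎) x₍₀₎` is a comodule map if `c` is cocentral. -/
lemma isComoduleHom_slice {c : C →ₗ[k] k}
    (hc : c.lTensor C ∘ₗ Coalgebra.comul =
      c.lTensor C ∘ₗ (TensorProduct.comm k C C).toLinearMap ∘ₗ Coalgebra.comul) :
    IsComoduleHom k C ((TensorProduct.lid k M).toLinearMap ∘ₗ c.rTensor M ∘ₗ coact k C) := by
  refine LinearMap.ext fun x ↦ ?_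
  simp only [LinearMap.comp_apply, LinearEquiv.coe_coe, coact_slice, LinearMap.lTensor_comp,
    ← coassoc_apply]
  generalize coact k C x = t
  induction t with
  | zero => simp
  | add a b ha hb => simp only [map_add, ha, hb]
  | tmul a m =>
    -- After coassociativity, one side evaluates `c` on the first leg of `Δ(a)` and the other on the
    -- second leg. Rewriting both through `c.lTensor` leaves exactly the cocentrality of `c`.
    have h1 : ∀ s : C ⊗[k] C, TensorProduct.lid k (C ⊗[k] M) (c.rTensor (C ⊗[k] M)
        (TensorProduct.assoc k C C M (s ⊗ₜ m))) =
        TensorProduct.rid k C (c.lTensor C (TensorProduct.comm k C C s)) ⊗ₜ m := by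
      intro s
      induction s with
      | zero => simp
      | add a b ha hb => simp only [map_add, TensorProduct.add_tmul, ha, hb]
      | tmul a b => simp [TensorProduct.smul_tmul']
    have h2 : ∀ s : C ⊗[k] C, (TensorProduct.lid k M).toLinearMap.lTensor C
        ((c.rTensor M).lTensor C (TensorProduct.assoc k C C M (s ⊗ₜ m))) =
        TensorProduct.rid k C (c.lTensor C s) ⊗ₜ m := by
      intro s
      induction s with
      | zero => simp
      | add a b ha hb => simp only [map_add, TensorProduct.add_tmul, ha, hb]
      | tmul a b => simp [TensorProduct.smul_tmul]
    have h3 := LinearMap.congr_fun hc a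
    simp only [LinearMap.comp_apply, LinearEquiv.coe_coe] at h3
    rw [LinearMap.rTensor_tmul, h1, h2, h3]

/-- The pushforward of a comodule along a map of coalgebras. -/
abbrev pushforwardComodule (φ : C →ₗc[k] D) (M : Type*) [AddCommGroup M] [Module k M]
    [LeftComodule k C M] : LeftComodule k D M where
  coact := (φ : C →ₗ[k] D).rTensor M ∘ₗ coact k C
  coassoc := by
    refine LinearMap.ext fun x ↦ ?_
    have h1 : ∀ t : C ⊗[k] M, TensorProduct.assoc k D D M
        (Coalgebra.comul.rTensor M ((φ : C →ₗ[k] D).rTensor M t)) =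
        TensorProduct.map (φ : C →ₗ[k] D) ((φ : C →ₗ[k] D).rTensor M)
          (TensorProduct.assoc k C C M (Coalgebra.comul.rTensor M t)) := by
      intro t
      induction t with
      | zero => simp
      | add a b ha hb => simp only [map_add, ha, hb]
      | tmul a m =>
        have h := CoalgHomClass.map_comp_comul_apply φ a
        simp only [LinearMap.rTensor_tmul]
        change TensorProduct.assoc k D D M (Coalgebra.comul (φ a) ⊗ₜ m) = _
        rw [← h]
        generalize Coalgebra.comul (R := k) a = s
        induction s with
        | zero => simp
        | add a b ha hb => simp only [map_add, TensorProduct.add_tmul, ha, hb]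
        | tmul a b => simp
    have h2 : ∀ t : C ⊗[k] M, ((φ : C →ₗ[k] D).rTensor M ∘ₗ coact k C).lTensor D
        ((φ : C →ₗ[k] D).rTensor M t) =
        TensorProduct.map (φ : C →ₗ[k] D) ((φ : C →ₗ[k] D).rTensor M)
          ((coact k C).lTensor C t) := by
      intro t
      induction t with
      | zero => simp
      | add a b ha hb => simp only [map_add, ha, hb]
      | tmul a m => simp
    simp only [LinearMap.comp_apply, LinearEquiv.coe_coe]
    rw [h1, h2, coassoc_apply]
  counit_coact := by
    refine LinearMap.ext fun x ↦ ?_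
    have h : Coalgebra.counit ∘ₗ (φ : C →ₗ[k] D) = Coalgebra.counit := φ.counit_comp
    simp only [LinearMap.comp_apply]
    rw [← LinearMap.comp_apply (LinearMap.rTensor M _) (LinearMap.rTensor M _),
      ← LinearMap.rTensor_comp, h]
    exact counit_coact_apply x

lemma IsComoduleHom.isSubcomodule_range {p : M →ₗ[k] M} (hp : IsComoduleHom k C p) :
    IsSubcomodule k C (LinearMap.range p) := by
  rintro _ ⟨x, rfl⟩
  have h := LinearMap.congr_fun hp x
  rw [LinearMap.comp_apply, LinearMap.comp_apply] at h
  refine ⟨p.rangeRestrict.lTensor C (coact k C x), ?_⟩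
  rw [h, ← LinearMap.comp_apply, ← LinearMap.lTensor_comp]
  rfl

/-- An idempotent comodule endomorphism `p` splits `M` into the subcomodules `im p` and `im (1 -
p)`, one of which must vanish. -/
lemma IsIndecomposableComodule.eq_zero_or_eq_id (hM : IsIndecomposableComodule k C M)
    {p : M →ₗ[k] M} (hp : IsComoduleHom k C p) (hp' : ∀ x, p (p x) = p x) :
    (∀ x, p x = 0) ∨ ∀ x, p x = x := by
  let q : M →ₗ[k] M := LinearMap.id - p
  have hq : IsComoduleHom k C q := by
    refine LinearMap.ext fun x ↦ ?_
    have h := LinearMap.congr_fun hp x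
    simp only [LinearMap.comp_apply] at h
    simp [q, LinearMap.lTensor_sub, h]
  have h : IsCompl (LinearMap.range p) (LinearMap.range q) := by
    refine IsCompl.of_eq ?_ ?_
    · refine (Submodule.eq_bot_iff _).2 ?_
      rintro _ ⟨⟨x, rfl⟩, ⟨y, hy⟩⟩
      have h := congrArg p hy
      simpa [q, hp', eq_comm] using h
    · refine (Submodule.eq_top_iff').2 fun x ↦ ?_
      have hx : x = p x + q x := by simp [q]
      rw [hx]
      exact Submodule.add_mem_sup ⟨x, rfl⟩ ⟨x, rfl⟩
  rcases hM.2 _ _ hp.isSubcomodule_range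
    hq.isSubcomodule_range h with h | h
  · left
    intro x
    exact (Submodule.eq_bot_iff _).1 h _ ⟨x, rfl⟩
  · right
    intro x
    exact (sub_eq_zero.1 ((Submodule.eq_bot_iff _).1 h _ ⟨x, rfl⟩)).symm

end Coalgebra

/-! ### Degrees of comodules with respect to a map to a group algebra -/

variable {k H Q : Type*} [Field k] [Ring H] [Bialgebra k H] [Group Q]

/-- All elements of the comodule `M` have degree `q` with respect to `ϖ : H → kQ`. -/
def HasDegree (ϖ : H →ₐc[k] MonoidAlgebra k Q) (M : Type*) [AddCommGroup M] [Module k M]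
    [LeftComodule k H M] (q : Q) : Prop :=
  ∀ x : M, (ϖ : H →ₗ[k] MonoidAlgebra k Q).rTensor M (coact k H x) =
    MonoidAlgebra.single q (1 : k) ⊗ₜ[k] x

variable {ϖ : H →ₐc[k] MonoidAlgebra k Q} {M N : Type*} [AddCommGroup M] [Module k M]
  [LeftComodule k H M] [AddCommGroup N] [Module k N] [LeftComodule k H N]

lemma IsComoduleHom.rTensor_coact {f : M →ₗ[k] N} (hf : IsComoduleHom k H f) (x : M) :
    (ϖ : H →ₗ[k] MonoidAlgebra k Q).rTensor N (coact k H (f x)) =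
      f.lTensor _ ((ϖ : H →ₗ[k] MonoidAlgebra k Q).rTensor M (coact k H x)) := by
  have h := LinearMap.congr_fun hf x
  rw [LinearMap.comp_apply, LinearMap.comp_apply] at h
  rw [h]
  exact LinearMap.congr_fun ((LinearMap.rTensor_comp_lTensor _ _ _).trans
    (LinearMap.lTensor_comp_rTensor _ _ _).symm) (coact k H x)

lemma HasDegree.of_injective {q : Q} (h : HasDegree ϖ N q) {f : M →ₗ[k] N}
    (hf : IsComoduleHom k H f) (hf' : Function.Injective f) : HasDegree ϖ M q := fun x ↦ by
  -- Over a field `id ⊗ f` stays injective, so the identity may be checked after applying it.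
  refine Module.Flat.lTensor_preserves_injective_linearMap (M := MonoidAlgebra k Q) f hf' ?_
  rw [← hf.rTensor_coact, h, LinearMap.lTensor_tmul]

lemma HasDegree.of_surjective {q : Q} (h : HasDegree ϖ M q) {f : M →ₗ[k] N}
    (hf : IsComoduleHom k H f) (hf' : Function.Surjective f) : HasDegree ϖ N q := fun x ↦ by
  obtain ⟨y, rfl⟩ := hf' x
  rw [hf.rTensor_coact, h, LinearMap.lTensor_tmul]

lemma HasDegree.of_isSubquotient {Z M : Type w} [AddCommGroup Z] [Module k Z] [LeftComodule k H Z]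
    [AddCommGroup M] [Module k M] [LeftComodule k H M] {q : Q} (h : HasDegree ϖ M q)
    (hZ : IsSubquotient k H Z M) : HasDegree ϖ Z q := by
  obtain ⟨P, _, _, _, i, p, hi, hi', hp, hp'⟩ := hZ
  exact (h.of_injective hi hi').of_surjective hp hp'

lemma hasDegree_trivial : HasDegree ϖ k (1 : Q) := fun x ↦ by
  change (ϖ : H →ₗ[k] MonoidAlgebra k Q).rTensor k ((1 : H) ⊗ₜ x) = _
  simp [MonoidAlgebra.one_def]

lemma coact_tmul (x : M) (y : N) :
    coact k H (x ⊗ₜ[k] y) = mulLegs k H M N (coact k H x ⊗ₜ coact k H y) := rfl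

/-- Degrees multiply because `ϖ` is multiplicative and therefore intertwines the two maps `mulLegs`.
-/
lemma HasDegree.tensor {q r : Q} (hM : HasDegree ϖ M q) (hN : HasDegree ϖ N r) :
    HasDegree ϖ (M ⊗[k] N) (q * r) := fun t ↦ by
  have h : (ϖ : H →ₗ[k] MonoidAlgebra k Q).rTensor (M ⊗[k] N) ∘ₗ mulLegs k H M N =
      mulLegs k _ M N ∘ₗ TensorProduct.map ((ϖ : H →ₗ[k] MonoidAlgebra k Q).rTensor M)
        ((ϖ : H →ₗ[k] MonoidAlgebra k Q).rTensor N) := by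
    ext a x b y
    simp
  induction t with
  | zero => simp
  | add a b ha hb => simp only [map_add, TensorProduct.tmul_add, ha, hb]
  | tmul x y =>
    have h1 := LinearMap.congr_fun h (coact k H x ⊗ₜ coact k H y)
    rw [LinearMap.comp_apply, LinearMap.comp_apply, TensorProduct.map_tmul, hM, hN,
      mulLegs_tmul, MonoidAlgebra.single_mul_single, one_mul] at h1
    exact h1

lemma HasDegree.unique [Nontrivial M] {q r : Q} (hq : HasDegree ϖ M q) (hr : HasDegree ϖ M r) :
    q = r := by
  obtain ⟨x, hx⟩ := exists_ne (0 : M)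
  by_contra h
  have h1 := congrArg (coeffAt k M q) ((hq x).symm.trans (hr x))
  simp [MonoidAlgebra.coeff_single, Ne.symm h] at h1
  exact hx h1

/-- For cocentral `ϖ` the projections onto the `kQ`-homogeneous components are idempotent
endomorphisms of `H`-comodules. Each is zero or the identity, and they cannot all be zero. -/
lemma IsIndecomposableComodule.exists_hasDegree (hϖ : IsCocentral ϖ)
    (hM : IsIndecomposableComodule k H M) : ∃ q, HasDegree ϖ M q := by
  let _ : LeftComodule k (MonoidAlgebra k Q) M :=
    pushforwardComodule (ϖ : H →ₗc[k] MonoidAlgebra k Q) M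
  let δ : Q → MonoidAlgebra k Q →ₗ[k] k := fun q ↦ Finsupp.lapply q ∘ₗ
    (MonoidAlgebra.coeffLinearEquiv k : MonoidAlgebra k Q ≃ₗ[k] (Q →₀ k)).toLinearMap
  let p : Q → M →ₗ[k] M := fun q ↦ (TensorProduct.lid k M).toLinearMap ∘ₗ
    (δ q ∘ₗ (ϖ : H →ₗ[k] MonoidAlgebra k Q)).rTensor M ∘ₗ coact k H
  -- The functional `δ_q ∘ ϖ` inherits cocentrality from `ϖ`.
  have hp : ∀ q, IsComoduleHom k H (p q) := fun q ↦ isComoduleHom_slice (by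
    rw [LinearMap.lTensor_comp, LinearMap.comp_assoc, hϖ]; rfl)
  have hpc : ∀ q x, p q x = coeffAt k M q (coact k (MonoidAlgebra k Q) x) := fun q x ↦ by
    simp only [p, LinearMap.rTensor_comp]
    rfl
  have hhom : ∀ q x, IsHomogeneous k Q q (p q x) := fun q x ↦ by
    rw [hpc]; exact isHomogeneous_coeffAt k q x
  have hfix : ∀ q x, IsHomogeneous k Q q x → p q x = x := fun q x hx ↦ by
    unfold IsHomogeneous at hx
    rw [hpc, hx]
    simp [MonoidAlgebra.coeff_single]
  have hq : ∃ q, ¬ ∀ x, p q x = 0 := by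
    by_contra! h
    have := hM.1
    obtain ⟨x, hx⟩ := exists_ne (0 : M)
    -- Homogeneous vectors are fixed by their projections and span `M`, so the vanishing of all
    -- projections would make `M` zero.
    have h0 : (LinearMap.id : M →ₗ[k] M) = 0 := linearMap_ext_homogeneous k (Γ := Q) fun q x hx ↦ by
      rw [← hfix q x hx, h]; simp
    exact hx (LinearMap.congr_fun h0 x)
  obtain ⟨q, hq⟩ := hq
  refine ⟨q, fun x ↦ ?_⟩
  have hx := (hM.eq_zero_or_eq_id (hp q) fun x ↦ hfix q _ (hhom q x)).resolve_left hq x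
  have h := hhom q x
  rw [hx] at h
  exact h

end GradedComodule

/-! ### Simple comodules over the bosonization -/

section SimpleComodules

open SkewMonoidAlgebra (single)

variable {k Γ V B M : Type*} [Field k] [Group Γ]
  [AddCommGroup V] [Module k V] [DistribMulAction Γ V]
  [SMulCommClass Γ k V] [LeftComodule k (MonoidAlgebra k Γ) V] [YetterDrinfeld k Γ V]
  [Ring B] [Algebra k B] [Coalgebra k B] [MulSemiringAction Γ B] [SMulCommClass Γ k B]
  [LeftComodule k (MonoidAlgebra k Γ) B] [BraidedHopfAlgebra k Γ B]
  [AddCommGroup M] [Module k M] [LeftComodule k (Bosonization Γ B) M]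

/-- An element `y` such that the components of positive degree of `ρ(y)` vanish. -/
lemma PreNicholsAlgebra.exists_gradeProj_coact_eq_zero (hB : PreNicholsAlgebra k Γ V B)
    [Nontrivial M] : ∃ y : M, y ≠ 0 ∧ ∀ j ≠ 0,
      (hB.gradeProj j).rTensor M (coact k (Bosonization Γ B) y) = 0 := by
  classical
  obtain ⟨m, hm⟩ := exists_ne (0 : M)
  obtain ⟨N, hN⟩ := hB.exists_eq_sum_gradeProj M (coact k (Bosonization Γ B) m)
  set t := coact k (Bosonization Γ B) m with ht
  have hvanish : ∀ n ≥ N, (hB.gradeProj n).rTensor M t = 0 := fun n hn ↦ by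
    have h1 := hN (n + 1) (by omega)
    rw [Finset.sum_range_succ, ← hN n hn] at h1
    exact left_eq_add.1 h1
  have hex : ∃ n, (hB.gradeProj n).rTensor M t ≠ 0 := by
    by_contra! h
    refine coact_ne_zero (k := k) (C := Bosonization Γ B) hm ?_
    rw [← ht, hN N le_rfl]
    exact Finset.sum_eq_zero fun n _ ↦ h n
  -- The highest degree that occurs in `ρ(m)`; it exists because only finitely many components are
  -- nonzero.
  obtain ⟨n, hn, hmax⟩ : ∃ n, (hB.gradeProj n).rTensor M t ≠ 0 ∧
      ∀ n' > n, (hB.gradeProj n').rTensor M t = 0 := by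
    obtain ⟨n₀, hn₀⟩ := hex
    have hle : n₀ ≤ N := by
      by_contra h
      exact hn₀ (hvanish n₀ (by omega))
    refine ⟨_, Nat.findGreatest_spec (P := fun n ↦ (hB.gradeProj n).rTensor M t ≠ 0) hle hn₀,
      fun n' h ↦ ?_⟩
    by_contra hne
    rcases le_or_gt n' N with h' | h'
    · exact Nat.findGreatest_is_greatest h h' hne
    · exact hne (hvanish n' h'.le)
  obtain ⟨i, hi⟩ := exists_slice_ne_zero (Module.Basis.ofVectorSpace k (Bosonization Γ B)) hn
  set f := (Module.Basis.ofVectorSpace k (Bosonization Γ B)).coord i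
  -- The vector is `y = f(πₙ(m₍₋₁₎)) m₍₀₎`, with `πₙ` the projection to degree `n`. By
  -- coassociativity and the grading of `Δ`, the degree `j` part of `ρ(y)` depends only on the
  -- degree `n + j` part of `ρ(m)`, which is zero for `j ≠ 0` by the maximality of `n`.
  refine ⟨_, hi, fun j hj ↦ ?_⟩
  have h1 : ∀ s : Bosonization Γ B ⊗[k] (Bosonization Γ B ⊗[k] M),
      (hB.gradeProj j).rTensor M (TensorProduct.lid k _
        ((f ∘ₗ hB.gradeProj n).rTensor _ s)) =
      TensorProduct.lid k _ (f.rTensor _ (TensorProduct.map (hB.gradeProj n)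
        ((hB.gradeProj j).rTensor M) s)) := by
    intro s
    induction s with
    | zero => simp
    | add a b ha hb => simp only [map_add, ha, hb]
    | tmul a y => simp
  have h2 : ∀ s : Bosonization Γ B ⊗[k] M,
      TensorProduct.map (hB.gradeProj n) ((hB.gradeProj j).rTensor M)
        (TensorProduct.assoc k _ _ _ (Coalgebra.comul.rTensor M s)) =
      TensorProduct.assoc k _ _ _
        ((TensorProduct.map (hB.gradeProj n) (hB.gradeProj j) ∘ₗ Coalgebra.comul).rTensor M
          ((hB.gradeProj (n + j)).rTensor M s)) := by
    intro s
    induction s with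
    | zero => simp
    | add a b ha hb => simp only [map_add, ha, hb]
    | tmul a y =>
      simp only [LinearMap.rTensor_tmul, LinearMap.comp_apply, ← hB.map_gradeProj_comul]
      generalize Coalgebra.comul (R := k) a = r
      induction r with
      | zero => simp
      | add a b ha hb => simp only [map_add, TensorProduct.add_tmul, ha, hb]
      | tmul a b => simp
  rw [← LinearMap.comp_apply (LinearMap.rTensor M _) (LinearMap.rTensor M _),
    ← LinearMap.rTensor_comp, coact_slice, h1, h2, ← ht, hmax (n + j) (by omega)]
  simp

/-- Every nonzero comodule contains a nonzero vector on which the coaction is `x ↦ g ⊗ x`. -/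
lemma PreNicholsAlgebra.exists_coact_eq_single (hB : PreNicholsAlgebra k Γ V B) [Nontrivial M] :
    ∃ (g : Γ) (x : M), x ≠ 0 ∧ coact k (Bosonization Γ B) x = single g 1 ⊗ₜ[k] x := by
  obtain ⟨y, hy, hy'⟩ := hB.exists_gradeProj_coact_eq_zero (M := M)
  let ι := (Bosonization.ofGroup k Γ B).toLinearMap
  let s := (Bosonization.proj k Γ B : Bosonization Γ B →ₗ[k] MonoidAlgebra k Γ).rTensor M
    (coact k (Bosonization Γ B) y)
  -- Only the degree zero component of `ρ(y)` survives, so `ρ(y)` comes from `kΓ ⊗ M`.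
  have hs : coact k (Bosonization Γ B) y = ι.rTensor M s := by
    obtain ⟨N, hN⟩ := hB.exists_eq_sum_gradeProj M (coact k (Bosonization Γ B) y)
    have h0 : hB.gradeProj 0 =
        ι ∘ₗ (Bosonization.proj k Γ B : Bosonization Γ B →ₗ[k] MonoidAlgebra k Γ) :=
      LinearMap.ext hB.gradeProj_zero
    rw [hN (N + 1) (by omega), Finset.sum_eq_single_of_mem 0 (by simp) fun j _ hj ↦ hy' j hj, h0,
      LinearMap.rTensor_comp, LinearMap.comp_apply]
  have hs0 : s ≠ 0 := fun h ↦ coact_ne_zero (k := k) (C := Bosonization Γ B) hy (by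
    rw [hs, h, map_zero])
  let b : Module.Basis Γ k (MonoidAlgebra k Γ) := ⟨MonoidAlgebra.coeffLinearEquiv k⟩
  obtain ⟨g, hg⟩ := exists_slice_ne_zero b hs0
  have hcoord : ∀ h r, b.coord g (MonoidAlgebra.single h r) =
      (MonoidAlgebra.single h r).coeff g := fun h r ↦ rfl
  -- Since `Δ(h) = h ⊗ h`, evaluating the coefficient of `g` on the first leg also selects `g` in
  -- the second. Hence slicing `ρ(y)` at `g` produces a vector with coaction `g ⊗ x`.
  have h1 : ∀ t : MonoidAlgebra k Γ ⊗[k] M, TensorProduct.lid k _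
      ((b.coord g ∘ₗ (Bosonization.proj k Γ B : Bosonization Γ B →ₗ[k] MonoidAlgebra k Γ)).rTensor _
        (TensorProduct.assoc k _ _ _ (Coalgebra.comul.rTensor M (ι.rTensor M t)))) =
      single g 1 ⊗ₜ[k] TensorProduct.lid k M ((b.coord g).rTensor M t) := by
    intro t
    induction t with
    | zero => simp
    | add a b ha hb => simp only [map_add, TensorProduct.tmul_add, ha, hb]
    | tmul a m =>
      induction a using MonoidAlgebra.induction_linear with
      | zero => simp
      | add a b ha hb => simp only [map_add, TensorProduct.add_tmul, TensorProduct.tmul_add, ha, hb]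
      | single h r =>
        rcases eq_or_ne h g with rfl | hne
        · simp [ι, PreNicholsAlgebra.comul_single_one, Bosonization.proj_single, hcoord,
            BraidedHopfAlgebra.counit_one Γ, MonoidAlgebra.coeff_single,
            TensorProduct.smul_tmul']
        · simp [ι, PreNicholsAlgebra.comul_single_one, Bosonization.proj_single, hcoord,
            BraidedHopfAlgebra.counit_one Γ, MonoidAlgebra.coeff_single, hne,
            TensorProduct.smul_tmul']
  refine ⟨g, _, hg, ?_⟩
  rw [← h1, ← hs, ← coact_slice, LinearMap.rTensor_comp]
  rfl

/-- A simple comodule is spanned by a vector on which the coaction is `x ↦ g ⊗ x`. -/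
lemma PreNicholsAlgebra.exists_span_eq_top (hB : PreNicholsAlgebra k Γ V B)
    (hM : IsSimpleComodule k (Bosonization Γ B) M) :
    ∃ (g : Γ) (x : M), x ≠ 0 ∧ Submodule.span k {x} = ⊤ ∧
      ∀ y : M, coact k (Bosonization Γ B) y = single g 1 ⊗ₜ[k] y := by
  have := hM.1
  obtain ⟨g, x, hx, hgx⟩ := hB.exists_coact_eq_single (M := M)
  have hmul : ∀ y ∈ Submodule.span k {x},
      coact k (Bosonization Γ B) y = single g 1 ⊗ₜ[k] y := fun y hy ↦ by
    obtain ⟨r, rfl⟩ := Submodule.mem_span_singleton.1 hy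
    rw [map_smul, hgx, TensorProduct.tmul_smul]
  have hspan : Submodule.span k {x} = ⊤ := by
    -- The line spanned by `x` is a nonzero subcomodule, hence everything by simplicity.
    refine (hM.2 _ fun y hy ↦ ?_).resolve_left (by simpa using hx)
    rw [hmul y hy]
    exact ⟨single g 1 ⊗ₜ ⟨y, hy⟩, rfl⟩
  exact ⟨g, x, hx, hspan, fun y ↦ hmul y (hspan ▸ Submodule.mem_top)⟩

variable (V) in
lemma hasDegree_of_coact_eq {g : Γ}
    (h : ∀ x : M, coact k (Bosonization Γ B) x = single g 1 ⊗ₜ[k] x) :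
    HasDegree (Bosonization.projQuotient k Γ B V) M (QuotientGroup.mk g) := fun x ↦ by
  rw [h, LinearMap.rTensor_tmul]
  exact congrArg (· ⊗ₜ[k] x) (projQuotient_single_one g)

lemma isComoduleHom_of_coact_eq {N : Type*} [AddCommGroup N] [Module k N]
    [LeftComodule k (Bosonization Γ B) N] {g : Γ}
    (hM : ∀ x : M, coact k (Bosonization Γ B) x = single g 1 ⊗ₜ[k] x)
    (hN : ∀ x : N, coact k (Bosonization Γ B) x = single g 1 ⊗ₜ[k] x) (f : M →ₗ[k] N) :
    IsComoduleHom k (Bosonization Γ B) f :=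
  LinearMap.ext fun x ↦ by
    rw [LinearMap.comp_apply, LinearMap.comp_apply, hM, hN, LinearMap.lTensor_tmul]

end SimpleComodules

/-! ### The one-dimensional comodules and their extensions -/

section Line

open SkewMonoidAlgebra (single)

/-- The two-dimensional comodule given by a skew-primitive element `w`. -/
abbrev extensionComodule {k C : Type*} [Field k] [AddCommGroup C] [Module k C] [Coalgebra k C]
    {u w z : C} (hu : Coalgebra.comul (R := k) u = u ⊗ₜ[k] u)
    (hz : Coalgebra.comul (R := k) z = z ⊗ₜ[k] z)
    (hw : Coalgebra.comul (R := k) w = w ⊗ₜ[k] u + z ⊗ₜ[k] w)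
    (hu' : Coalgebra.counit (R := k) u = 1) (hz' : Coalgebra.counit (R := k) z = 1)
    (hw' : Coalgebra.counit (R := k) w = 0) : LeftComodule k C (k × k) where
  -- The vector `(1, 0)` spans a subcomodule given by `u`, with quotient given by `z`.
  -- Coassociativity at `(0, 1)` is the formula for `Δ(w)`.
  coact := (LinearMap.fst k k k).smulRight (u ⊗ₜ[k] ((1 : k), (0 : k))) +
    (LinearMap.snd k k k).smulRight
      (w ⊗ₜ[k] ((1 : k), (0 : k)) + z ⊗ₜ[k] ((0 : k), (1 : k)))
  coassoc := by
    refine LinearMap.prod_ext (LinearMap.ext_ring ?_) (LinearMap.ext_ring ?_)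
    · simp [hu]
    · simp [hw, hz, TensorProduct.add_tmul, TensorProduct.tmul_add, add_assoc]
  counit_coact := by
    refine LinearMap.prod_ext (LinearMap.ext_ring ?_) (LinearMap.ext_ring ?_)
    · simp [hu']
    · simp [hw', hz']

/-- The one-dimensional comodule over the bosonization with coaction `1 ↦ g ⊗ 1`. -/
def Line (k : Type*) {Γ : Type*} (_ : Γ) : Type _ := k

variable {k Γ V B : Type*} [Field k] [Group Γ]
  [AddCommGroup V] [Module k V] [DistribMulAction Γ V]
  [SMulCommClass Γ k V] [LeftComodule k (MonoidAlgebra k Γ) V] [YetterDrinfeld k Γ V]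
  [Ring B] [Algebra k B] [Coalgebra k B] [MulSemiringAction Γ B] [SMulCommClass Γ k B]
  [LeftComodule k (MonoidAlgebra k Γ) B] [BraidedHopfAlgebra k Γ B]

instance (g : Γ) : AddCommGroup (Line k g) := inferInstanceAs (AddCommGroup k)

instance (g : Γ) : Module k (Line k g) := inferInstanceAs (Module k k)

instance (g : Γ) : Nontrivial (Line k g) := inferInstanceAs (Nontrivial k)

/-- The identity map `k → k_g`. -/
def Line.equiv (k : Type*) [Field k] {Γ : Type*} (g : Γ) : k ≃ₗ[k] Line k g := LinearEquiv.refl k k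

instance (g : Γ) : LeftComodule k (Bosonization Γ B) (Line k g) where
  coact := TensorProduct.mk k (Bosonization Γ B) (Line k g) (single g 1)
  coassoc := by
    refine LinearMap.ext fun x ↦ ?_
    simp [PreNicholsAlgebra.comul_single_one]
  counit_coact := by
    refine LinearMap.ext fun x ↦ ?_
    simp [Bosonization.counit_single, BraidedHopfAlgebra.counit_one Γ]

lemma Line.coact_eq (g : Γ) (x : Line k g) :
    coact k (Bosonization Γ B) x = single g 1 ⊗ₜ[k] x := rfl

lemma Line.isSimpleComodule (g : Γ) : IsSimpleComodule k (Bosonization Γ B) (Line k g) :=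
  ⟨inferInstance, fun N _ ↦ (eq_bot_or_eq_top (α := Ideal k) N)⟩

namespace PreNicholsAlgebra

/-- The extension of `k_g` by the trivial comodule given by `v ∈ V_g`; it is isomorphic to the
subcomodule of the bosonization spanned by `1` and `v`. -/
abbrev extension (hB : PreNicholsAlgebra k Γ V B) {g : Γ} {v : V}
    (hv : IsHomogeneous k Γ g v) : LeftComodule k (Bosonization Γ B) (k × k) :=
  extensionComodule (u := 1) (w := single 1 (hB.incl v)) (z := single g 1)
    (PreNicholsAlgebra.comul_single_one 1) (PreNicholsAlgebra.comul_single_one g)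
    (hB.comul_incl hv)
    (by simp) (by simp [Bosonization.counit_single, BraidedHopfAlgebra.counit_one Γ])
    (by simp [Bosonization.counit_single, hB.counit_eq_zero 1 _ one_ne_zero (hB.incl_mem v)])

lemma coact_extension (hB : PreNicholsAlgebra k Γ V B) {g : Γ} {v : V}
    (hv : IsHomogeneous k Γ g v) (a b : k) : letI := hB.extension hv
    coact k (Bosonization Γ B) (a, b) =
      a • ((1 : Bosonization Γ B) ⊗ₜ[k] ((1 : k), (0 : k))) +
      b • ((single 1 (hB.incl v) : Bosonization Γ B) ⊗ₜ[k] ((1 : k), (0 : k)) +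
        (single g 1 : Bosonization Γ B) ⊗ₜ[k] ((0 : k), (1 : k))) := rfl

/-- Every proper subcomodule lies in the line spanned by `(1, 0)`, so two proper subcomodules cannot
add up to the whole space. -/
lemma isIndecomposable_extension (hB : PreNicholsAlgebra k Γ V B) {g : Γ} {v : V}
    (hv : IsHomogeneous k Γ g v) (h0 : v ≠ 0) : letI := hB.extension hv
    IsIndecomposableComodule k (Bosonization Γ B) (k × k) := by
  let _ := hB.extension hv
  obtain ⟨f, hf, hf'⟩ := hB.exists_functional h0
  have h1 : f 1 = 0 := hf' 1
  have key : ∀ N : Submodule k (k × k), IsSubcomodule k (Bosonization Γ B) N →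
      N = ⊤ ∨ N ≤ LinearMap.ker (LinearMap.snd k k k) := by
    intro N hN
    by_contra! h
    obtain ⟨hN1, hN2⟩ := h
    obtain ⟨⟨a, b⟩, hx, hb⟩ := SetLike.not_le_iff_exists.1 hN2
    simp only [LinearMap.mem_ker, LinearMap.snd_apply] at hb
    -- A nonzero functional `φ` vanishing on a proper `N` satisfies `(id ⊗ φ) ρ(a, b) = 0`. With `b
    -- ≠ 0`, evaluating the first leg by `f` gives `φ(1, 0) = 0`, and evaluating it by the counit
    -- then gives `φ(0, 1) = 0`, a contradiction.
    obtain ⟨φ, hφ, hφN⟩ := Submodule.exists_le_ker_of_lt_top N (lt_top_iff_ne_top.2 hN1)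
    obtain ⟨t, ht⟩ := hN _ hx
    have h2 : φ.lTensor (Bosonization Γ B) (coact k (Bosonization Γ B) (a, b)) = 0 := by
      rw [← ht, ← LinearMap.comp_apply, ← LinearMap.lTensor_comp]
      have : φ ∘ₗ N.subtype = 0 := LinearMap.ext fun y ↦ hφN y.2
      rw [this]
      simp
    rw [hB.coact_extension hv] at h2
    have h3 := congrArg (TensorProduct.lid k k) (congrArg (f.rTensor k) h2)
    have hp : φ (1, 0) = 0 := by simpa [hf, hf', h1, hb] using h3
    have h4 := congrArg (TensorProduct.lid k k) (congrArg (Coalgebra.counit.rTensor k) h2)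
    have hq : φ (0, 1) = 0 := by
      simpa [hp, hb, Bosonization.counit_single, BraidedHopfAlgebra.counit_one Γ] using h4
    refine hφ ?_
    ext
    · simpa using hp
    · simpa using hq
  refine ⟨inferInstance, fun N N' hN hN' hc ↦ ?_⟩
  rcases key N hN with rfl | h
  · right
    simpa using hc.inf_eq_bot
  · rcases key N' hN' with rfl | h'
    · left
      simpa using hc.inf_eq_bot
    · have h2 : ((0 : k), (1 : k)) ∈ N ⊔ N' := by rw [hc.sup_eq_top]; trivial
      have h3 := sup_le h h' h2
      simp at h3

end PreNicholsAlgebra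

end Line

/-! ### The universal grading group of the bosonization -/

section UniversalGradingGroup

open SkewMonoidAlgebra (single)

lemma gradeOf_relation {k : Type u} {H : Type w} [Field k] [Ring H] [Bialgebra k H]
    {r : FreeGroup (SimpleComodule k H)} (hr : GradingRelation k H r) :
    PresentedGroup.mk {w | GradingRelation k H w} r = 1 :=
  PresentedGroup.one_of_mem hr

variable {k Γ V B : Type u} [Field k] [Group Γ]
  [AddCommGroup V] [Module k V] [DistribMulAction Γ V]
  [SMulCommClass Γ k V] [LeftComodule k (MonoidAlgebra k Γ) V] [YetterDrinfeld k Γ V]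
  [Ring B] [Algebra k B] [Coalgebra k B] [MulSemiringAction Γ B] [SMulCommClass Γ k B]
  [LeftComodule k (MonoidAlgebra k Γ) B] [BraidedHopfAlgebra k Γ B]

/-- The one-dimensional simple comodule with coaction `1 ↦ g ⊗ 1`. -/
def Line.simple (k : Type u) {Γ : Type u} (B : Type u) [Field k] [Group Γ] [Ring B] [Algebra k B]
    [Coalgebra k B] [MulSemiringAction Γ B] [SMulCommClass Γ k B]
    [LeftComodule k (MonoidAlgebra k Γ) B] [BraidedHopfAlgebra k Γ B] (g : Γ) :
    SimpleComodule k (Bosonization Γ B) where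
  carrier := Line k g
  isSimple := Line.isSimpleComodule g

lemma gradeOf_eq_of_iso {X Y : SimpleComodule k (Bosonization Γ B)}
    (f : X.carrier ≃ₗ[k] Y.carrier)
    (hf : IsComoduleHom k (Bosonization Γ B) f.toLinearMap) :
    gradeOf k (Bosonization Γ B) X = gradeOf k (Bosonization Γ B) Y := by
  have h := gradeOf_relation (GradingRelation.iso X Y f hf)
  rw [map_mul, map_inv] at h
  exact mul_inv_eq_one.1 h

lemma gradeOf_line_one : gradeOf k (Bosonization Γ B) (Line.simple k B (1 : Γ)) = 1 :=
  gradeOf_relation (GradingRelation.unit _ (Line.equiv k (1 : Γ)).symm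
    (LinearMap.ext fun _ ↦ rfl))

/-- Multiplication of scalars maps the comodule `k_g ⊗ k_h` onto `k_{gh}`, so the tensor relation
applies. -/
lemma gradeOf_line_mul (g h : Γ) : gradeOf k (Bosonization Γ B) (Line.simple k B (g * h)) =
    gradeOf k (Bosonization Γ B) (Line.simple k B g) *
      gradeOf k (Bosonization Γ B) (Line.simple k B h) := by
  let f : Line k g ⊗[k] Line k h →ₗ[k] Line k (g * h) := (Line.equiv k (g * h)).toLinearMap ∘ₗ
    LinearMap.mul' k k ∘ₗ
      TensorProduct.map (Line.equiv k g).symm.toLinearMap (Line.equiv k h).symm.toLinearMap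
  have hf : Function.Surjective f := fun x ↦
    ⟨Line.equiv k g 1 ⊗ₜ Line.equiv k h ((Line.equiv k (g * h)).symm x), by simp [f]⟩
  have hρ : ∀ t : Line k g ⊗[k] Line k h,
      coact k (Bosonization Γ B) t = single (g * h) 1 ⊗ₜ[k] t := by
    intro t
    induction t with
    | zero => simp
    | add a b ha hb => rw [map_add, ha, hb, TensorProduct.tmul_add]
    | tmul x y => simp [coact_tmul, Line.coact_eq]
  have hr := gradeOf_relation (GradingRelation.tensor (Line.simple k B g) (Line.simple k B h)
    (Line.simple k B (g * h))
    ⟨Line k g ⊗[k] Line k h, _, _, inferInstance, LinearMap.id, f, isComoduleHom_id,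
      Function.injective_id, isComoduleHom_of_coact_eq hρ (Line.coact_eq (g * h)) f, hf⟩)
  rw [map_mul, map_mul, map_inv] at hr
  exact (mul_inv_eq_one.1 hr).symm

/-- The extension defined by `v` is indecomposable with `k_1` as a subcomodule and `k_g` as a
quotient, so the two are linked. -/
lemma PreNicholsAlgebra.gradeOf_line_eq_one (hB : PreNicholsAlgebra k Γ V B) {g : Γ} {v : V}
    (hv : IsHomogeneous k Γ g v) (h0 : v ≠ 0) :
    gradeOf k (Bosonization Γ B) (Line.simple k B g) = 1 := by
  let _ := hB.extension hv
  let i : Line k (1 : Γ) →ₗ[k] k × k :=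
    LinearMap.inl k k k ∘ₗ (Line.equiv k (1 : Γ)).symm.toLinearMap
  let p : k × k →ₗ[k] Line k g := (Line.equiv k g).toLinearMap ∘ₗ LinearMap.snd k k k
  have hi : IsComoduleHom k (Bosonization Γ B) i := by
    refine LinearMap.ext fun x ↦ ?_
    obtain ⟨x, rfl⟩ := (Line.equiv k (1 : Γ)).surjective x
    simp only [i, LinearMap.comp_apply, LinearEquiv.coe_coe, LinearEquiv.symm_apply_apply,
      LinearMap.inl_apply, hB.coact_extension hv, Line.coact_eq, LinearMap.lTensor_tmul]
    rw [zero_smul, add_zero, ← TensorProduct.tmul_smul]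
    simp
  have hp : IsComoduleHom k (Bosonization Γ B) p := by
    refine LinearMap.ext fun x ↦ ?_
    obtain ⟨a, b⟩ := x
    simp only [p, LinearMap.comp_apply, hB.coact_extension hv, Line.coact_eq, map_add, map_smul,
      LinearMap.lTensor_tmul, LinearMap.snd_apply, LinearEquiv.coe_coe, map_zero,
      TensorProduct.tmul_zero, smul_zero, zero_add]
    rw [← TensorProduct.tmul_smul, ← map_smul, smul_eq_mul, mul_one]
  have hr := gradeOf_relation (GradingRelation.linked (Line.simple k B (1 : Γ))
    (Line.simple k B g) (k × k) (hB.isIndecomposable_extension hv h0)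
    ⟨Line k (1 : Γ), _, _, inferInstance, i, LinearMap.id, hi,
      (LinearMap.inl_injective).comp (Line.equiv k (1 : Γ)).symm.injective,
      isComoduleHom_id, Function.surjective_id⟩
    ⟨k × k, _, _, hB.extension hv, LinearMap.id, p, isComoduleHom_id,
      Function.injective_id, hp, (Line.equiv k g).surjective.comp (LinearMap.snd_surjective (R := k))⟩)
  rw [map_mul, map_inv] at hr
  exact (mul_inv_eq_one.1 hr).symm.trans gradeOf_line_one

/-! ### The two mutually inverse homomorphisms -/

/-- The homomorphism `[g] ↦ g_X` with `X` the one-dimensional comodule given by `g`. -/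
def PreNicholsAlgebra.lineHom (hB : PreNicholsAlgebra k Γ V B) :
    Γ ⧸ supp k Γ V →* UniversalGradingGroup k (Bosonization Γ B) :=
  QuotientGroup.lift (supp k Γ V)
    { toFun := fun g ↦ gradeOf k (Bosonization Γ B) (Line.simple k B g)
      map_one' := gradeOf_line_one
      map_mul' := gradeOf_line_mul }
    ((Subgroup.closure_le _).2 (by
      rintro g ⟨v, h0, hv⟩
      exact hB.gradeOf_line_eq_one hv h0))

/-- `X` is isomorphic to a line `k_g`. Recording the grade and the degree for the same `g` is what
later identifies the two homomorphisms as inverse to each other. -/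
lemma PreNicholsAlgebra.exists_gradeOf_eq (hB : PreNicholsAlgebra k Γ V B)
    (X : SimpleComodule k (Bosonization Γ B)) :
    ∃ g : Γ, gradeOf k (Bosonization Γ B) X = gradeOf k (Bosonization Γ B) (Line.simple k B g) ∧
      HasDegree (Bosonization.projQuotient k Γ B V) X.carrier (QuotientGroup.mk g) := by
  obtain ⟨g, x, hx, hspan, hρ⟩ := hB.exists_span_eq_top X.isSimple
  let f : Line k g ≃ₗ[k] X.carrier := (Line.equiv k g).symm.trans
    ((LinearEquiv.toSpanNonzeroSingleton k X.carrier x hx).trans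
      (LinearEquiv.ofTop _ hspan))
  exact ⟨g, (gradeOf_eq_of_iso (X := Line.simple k B g) f
    (isComoduleHom_of_coact_eq (Line.coact_eq g) hρ f.toLinearMap)).symm,
    hasDegree_of_coact_eq V hρ⟩

/-- The degree of a simple comodule. -/
def PreNicholsAlgebra.degree (hB : PreNicholsAlgebra k Γ V B)
    (X : SimpleComodule k (Bosonization Γ B)) : Γ ⧸ supp k Γ V :=
  QuotientGroup.mk (hB.exists_gradeOf_eq X).choose

lemma PreNicholsAlgebra.hasDegree_degree (hB : PreNicholsAlgebra k Γ V B)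
    (X : SimpleComodule k (Bosonization Γ B)) :
    HasDegree (Bosonization.projQuotient k Γ B V) X.carrier (hB.degree X) :=
  (hB.exists_gradeOf_eq X).choose_spec.2

/-- The degree does not depend on the chosen `g`, because a nonzero comodule has at most one degree.
-/
lemma PreNicholsAlgebra.degree_eq (hB : PreNicholsAlgebra k Γ V B)
    {X : SimpleComodule k (Bosonization Γ B)} {q : Γ ⧸ supp k Γ V}
    (h : HasDegree (Bosonization.projQuotient k Γ B V) X.carrier q) : hB.degree X = q := by
  have := X.isSimple.1
  exact (hB.hasDegree_degree X).unique h

/-- Each defining relation is a stability property of `HasDegree`: under injective and surjective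
comodule maps, for the trivial comodule, and under tensor products. -/
lemma PreNicholsAlgebra.lift_degree_eq_one (hB : PreNicholsAlgebra k Γ V B)
    (r : FreeGroup (SimpleComodule k (Bosonization Γ B)))
    (hr : GradingRelation k (Bosonization Γ B) r) : FreeGroup.lift hB.degree r = 1 := by
  cases hr with
  | iso X Y f hf =>
    rw [map_mul, map_inv, FreeGroup.lift_apply_of, FreeGroup.lift_apply_of, mul_inv_eq_one]
    exact hB.degree_eq ((hB.hasDegree_degree Y).of_injective hf f.injective)
  | unit X f hf =>
    rw [FreeGroup.lift_apply_of]
    exact hB.degree_eq (hasDegree_trivial.of_injective hf f.injective)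
  | tensor X Y Z hZ =>
    rw [map_mul, map_mul, map_inv, FreeGroup.lift_apply_of, FreeGroup.lift_apply_of,
      FreeGroup.lift_apply_of, mul_inv_eq_one]
    exact (hB.degree_eq
      (((hB.hasDegree_degree X).tensor (hB.hasDegree_degree Y)).of_isSubquotient hZ)).symm
  | linked X Y E hE hX hY =>
    -- Only this relation needs the cocentrality of `ϖ`: it gives all of `E`, and so all its
    -- subquotients, one degree.
    obtain ⟨q, hq⟩ := hE.exists_hasDegree (hB.isCocentral_projQuotient)
    rw [map_mul, map_inv, FreeGroup.lift_apply_of, FreeGroup.lift_apply_of, mul_inv_eq_one,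
      hB.degree_eq (hq.of_isSubquotient hX), hB.degree_eq (hq.of_isSubquotient hY)]

lemma PreNicholsAlgebra.hasDegree_line (_ : PreNicholsAlgebra k Γ V B) (g : Γ) :
    HasDegree (Bosonization.projQuotient k Γ B V) (Line.simple k B g).carrier
      (QuotientGroup.mk g) :=
  hasDegree_of_coact_eq (k := k) (M := Line k g) V (Line.coact_eq g)

/-- The universal grading group of the bosonization is `Γ / supp V`. -/
def PreNicholsAlgebra.gradingEquiv (hB : PreNicholsAlgebra k Γ V B) :
    UniversalGradingGroup k (Bosonization Γ B) ≃* Γ ⧸ supp k Γ V :=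
  MonoidHom.toMulEquiv (PresentedGroup.toGroup (f := hB.degree) hB.lift_degree_eq_one) hB.lineHom
    (PresentedGroup.ext fun X ↦ by
      rw [MonoidHom.comp_apply, PresentedGroup.toGroup.of]
      exact (hB.exists_gradeOf_eq X).choose_spec.1.symm)
    (MonoidHom.ext fun q ↦ by
      obtain ⟨g, rfl⟩ := QuotientGroup.mk_surjective q
      exact (PresentedGroup.toGroup.of hB.lift_degree_eq_one).trans
        (hB.degree_eq (hB.hasDegree_line g)))

lemma PreNicholsAlgebra.gradingEquiv_gradeOf (hB : PreNicholsAlgebra k Γ V B)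
    (X : SimpleComodule k (Bosonization Γ B)) :
    hB.gradingEquiv (gradeOf k (Bosonization Γ B) X) = hB.degree X :=
  PresentedGroup.toGroup.of hB.lift_degree_eq_one

end UniversalGradingGroup

end ZestingHopf

end

theorem mainTheorem5 {k Γ V B : Type u} [Field k] [Group Γ]
    [AddCommGroup V] [Module k V] [FiniteDimensional k V] [DistribMulAction Γ V]
    [SMulCommClass Γ k V] [LeftComodule k (MonoidAlgebra k Γ) V] [YetterDrinfeld k Γ V]
    [Ring B] [Algebra k B] [Coalgebra k B] [MulSemiringAction Γ B] [SMulCommClass Γ k B]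
    [LeftComodule k (MonoidAlgebra k Γ) B] [BraidedHopfAlgebra k Γ B]
    (hB : PreNicholsAlgebra k Γ V B) :
    (∃ e : UniversalGradingGroup k (Bosonization Γ B) ≃* Γ ⧸ supp k Γ V,
      ∀ (X : SimpleComodule k (Bosonization Γ B)) (x : X.carrier),
        (Bosonization.projQuotient k Γ B V :
            Bosonization Γ B →ₗ[k] MonoidAlgebra k (Γ ⧸ supp k Γ V)).rTensor X.carrier
          (coact k (Bosonization Γ B) x) =
        MonoidAlgebra.single (e (gradeOf k (Bosonization Γ B) X)) (1 : k) ⊗ₜ[k] x) ∧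
    (IsCocentral (Bosonization.projQuotient k Γ B V) ∧
      Function.Surjective (Bosonization.projQuotient k Γ B V) ∧
      ∀ (G : Type u) [Group G] (π : Bosonization Γ B →ₐc[k] MonoidAlgebra k G), IsCocentral π →
        ∃! f : Γ ⧸ supp k Γ V →* G,
          (MonoidAlgebra.mapDomainBialgHom k f).comp (Bosonization.projQuotient k Γ B V) = π) ∧
    ((∀ x : V, IsHomogeneous k Γ 1 x → x = 0) →
      IsHopfCocenter (Bosonization.projQuotient k Γ B V)) := by
  refine ⟨⟨hB.gradingEquiv, fun X x ↦ ?_⟩,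
    ⟨hB.isCocentral_projQuotient, projQuotient_surjective,
      fun G _ π hπ ↦ hB.existsUnique_monoidHom hπ⟩,
    hB.isHopfCocenter_projQuotient⟩
  rw [hB.gradingEquiv_gradeOf]
  exact hB.hasDegree_degree X x
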